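/- **Setting.** Let $n,r\ge 0$ and let $\mathcal F$ be the algebra of functions on the infinite jet space of the trivial bundle $\mathbb R^n\times\mathbb R^r\to\mathbb R^n$, i.e. the algebra of smooth functions of $x=(x^1,\dots,x^n)$ and of finitely many of the fibre coordinates $u^a_\alpha$ ($1\le a\le r$, $\alpha\in\mathbb N^n$), with total derivatives $D_i=\partial_{x^i}+\sum u^a_{\alpha+e_i}\partial_{u^a_\alpha}$. Put $\mathcal O=C^\infty(\mathbb R^n)$, and let $\mathcal D$ be the ring of linear differential operators on $\mathbb R^n$; it acts on $\mathcal F$ through $\partial_{x^i}\mapsto D_i$. A differential graded $\mathcal F[\mathcal D]$-algebra is a (non-negatively graded, homological) differential graded commutative $\mathcal F$-algebra with a compatible $\mathcal D$-action for which vector fields act as degree $0$ derivations and whose differential is $\mathcal F$- and $\mathcal D$-linear; morphisms are the $\mathcal F$- and $\mathcal D$-linear algebra morphisms of degree $0$ that commute with the differentials. *Regular first-order reducible gauge theory.* Let $L\in\mathcal F$ with $L(x,0)=0$, with Euler–Lagrange functions $\delta_aL=\sum_\alpha(-1)^{|\alpha|}D^\alpha\partial_{u^a_\alpha}L$ of order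 $\le k$. Let $\Sigma$ (the shell) be the set of jets at which all $D^\alpha\delta_aL$ vanish, $\Sigma^\ell$ the set of jets at which those with $|\alpha|\le\ell$ vanish, and $I(\Sigma)\subset\mathcal F$ the ideal of functions vanishing on $\Sigma$. It is assumed that the equation $\delta_aL=0$ is formally integrable (the $(k+\ell)$-jet of each point of $\Sigma^\ell$ is the $(k+\ell)$-jet of a point of $\Sigma^{\ell+1}$, for all $\ell$); that there is a non-trivial Noether identity, $\sum N^a_\alpha D^\alpha\delta_aL=0$ with $N^a_\alpha\in\mathcal F$ not all in $I(\Sigma)$; and that the following hold. 1. There are two packages $(E_{\mathfrak a})$ and $(E_\Delta)$ of combinations of the functions $D^\alpha\delta_aL$, related to the latter by an invertible matrix over $\mathcal F$, in such a way that for every $\ell$ the matrix relates the members of level $\le\ell$ of the packages and the $D^\alpha\delta_aL$ with $|\alpha|\le\ell$. 2. The $E_{\mathfrak a}$ of level $\le\ell$ have order $\le k+\ell$, and at each point of $\Sigma$ the $E_{\mathfrak a}$ are independent in the fibre coordinates: the rows $(\partial E_{\mathfrak a}/\partial u^a_\alpha)$ are linearly independent over $\mathbb R$. 3. $E_\Delta=\sum_{\mathfrak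 a}F_\Delta^{\mathfrak a}E_{\mathfrak a}$ with $F_\Delta^{\mathfrak a}\in\mathcal F$, where for $E_\Delta$ of level $\ell$ only $E_{\mathfrak a}$ of level $\le\ell$ occur and the coefficients have order $\le k+\ell$. 4. The dependent equations are indexed by $\Delta=(\delta,\beta)$, $\delta\in\{1,\dots,K\}$, $\beta\in\mathbb N^n$, and $E_{(\delta,\beta)}=D^\beta E_\delta$, where $E_\delta=E_{(\delta,0)}$. 5. (First-order reducibility.) Let $R_\delta=\sum R^a_{\delta\alpha}D^\alpha$ be the Noether operator obtained by writing the Noether identity $E_\delta-\sum_{\mathfrak b}F^{\mathfrak b}_\delta E_{\mathfrak b}=0$ formally in terms of the $D^\alpha\delta_aL$, so that $\sum R^a_{\delta\alpha}D^\alpha\delta_aL=0$. Written formally in terms of the packages, $D^\beta\circ R_\delta=\sum_{\Delta}A_{(\delta,\beta)}^{\Delta}E_\Delta+\sum_{\mathfrak a}c^{\mathfrak a}_{(\delta,\beta)}E_{\mathfrak a}$, and the matrix $A$ is invertible. Then $I(\Sigma)$ is stable under the $D_i$, and $C^\infty(\Sigma):=\mathcal F/I(\Sigma)$ carries an induced $\mathcal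 D$-action. *The two complexes.* The Koszul–Tate resolution of the theory is $\mathrm{KT}=\mathcal F\otimes_{\mathcal O}\mathcal S_{\mathcal O}V$, where $V$ is the free graded $\mathcal D$-module on the antifields $\phi^*_a$ ($1\le a\le r$, degree $1$) and $C^*_\delta$ ($1\le\delta\le K$, degree $2$), with the $\mathcal F$- and $\mathcal D$-linear graded derivation given by $$\delta_{\mathrm{KT}}\phi^*_a=\delta_aL,\qquad \delta_{\mathrm{KT}}C^*_\delta=\sum R^a_{\delta\alpha}\,(\partial^\alpha\cdot\phi^*_a).$$ The cofibrant replacement Koszul–Tate resolution of $C^\infty(\Sigma)$ is $\mathcal{KT}=\mathcal F\otimes_{\mathcal O}\mathcal S_{\mathcal O}\mathcal V$, where $\mathcal V$ is the free graded $\mathcal D$-module on the generators of the following stages. Stage $0$ has a generator $\mathbb I_f$ of degree $0$, with differential $0$, for each $f\in C^\infty(\Sigma)$; the map $q$ to $C^\infty(\Sigma)$ is $F\mapsto[F]$ on $\mathcal F$ and $\mathbb I_f\mapsto f$. Stage $k+1$ adds to stage $k$ a generator $\mathbb I^{k+1}_{\sigma,0}$ of degree $m+1$, with differential $\sigma$ and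 $q(\mathbb I^{k+1}_{\sigma,0})=0$, for each $m\ge 0$ and each cycle $\sigma$ of degree $m$ of stage $k$ with $q(\sigma)=0$. The differential $\delta_{\mathcal{KT}}$ and the map $q$ are extended to $\mathcal{KT}$ as an $\mathcal F$- and $\mathcal D$-linear graded derivation and an $\mathcal F$- and $\mathcal D$-linear algebra morphism. **Proposition.** For every regular first-order reducible gauge theory: (a) $(\mathrm{KT},\delta_{\mathrm{KT}})$ and $(\mathcal{KT},\delta_{\mathcal{KT}})$ are differential graded $\mathcal F[\mathcal D]$-algebras, and $q:\mathcal{KT}\to C^\infty(\Sigma)$ is a surjective morphism of differential graded $\mathcal F[\mathcal D]$-algebras that is bijective in homology ($C^\infty(\Sigma)$ being concentrated in degree $0$). (b) $(\mathrm{KT},\delta_{\mathrm{KT}})$ is a differential graded $\mathcal F[\mathcal D]$-subalgebra of $(\mathcal{KT},\delta_{\mathcal{KT}})$: there is an injective morphism of differential graded $\mathcal F[\mathcal D]$-algebras $i:\mathrm{KT}\to\mathcal{KT}$ that sends each antifield $\phi^*_a$, $C^*_\delta$ to one of the generators of $\mathcal V$. (c) The generators below exist in $\mathcal V$, and there is a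 unique morphism of differential graded $\mathcal F[\mathcal D]$-algebras $i:\mathrm{KT}\to\mathcal{KT}$ with $$i(\phi^*_a)=\mathbb I^1_{\delta_aL,\,0},\qquad i(C^*_\delta)=\mathbb I^2_{\sum R^a_{\delta\alpha}\left(\partial^\alpha\cdot\mathbb I^1_{\delta_aL,0}\right),\,0}$$ for all $a$ and $\delta$. It is injective if and only if the functions $\delta_1L,\dots,\delta_rL$ are pairwise distinct. -/

import Mathlib

namespace KoszulTate

/-- Multi-indices `α ∈ ℕ^n`; `α.degree` is `|α|`. -/
abbrev MultiIndex (n : ℕ) : Type := Fin n →₀ ℕ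

/-- Additive endomorphisms; multiplication is composition. -/
abbrev AddEnd (A : Type) [AddCommGroup A] : Type := AddMonoid.End A

/-- `∂^α = ∂₁^(α₁) ∘ ⋯ ∘ ∂ₙ^(αₙ)`. -/
def iterD {n : ℕ} {A : Type} [AddCommGroup A] (pd : Fin n → AddEnd A)
    (α : MultiIndex n) : AddEnd A :=
  ((List.finRange n).map fun i => pd i ^ α i).prod

/-- A commutative real algebra with derivations `D₁, …, Dₙ` by which the vector fields
`∂/∂x¹, …, ∂/∂xⁿ` act (they commute in both cases used below). -/
class DRing (n : ℕ) (R : Type) [CommRing R] [Algebra ℝ R] where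
  der : Fin n → Derivation ℝ R R

/-- The derivation `Dᵢ` as an additive map. -/
def DRing.pd {n : ℕ} {R : Type} [CommRing R] [Algebra ℝ R] [DRing n R] (i : Fin n) :
    AddEnd R :=
  (DRing.der (R := R) i).toLinearMap.toAddMonoidHom

namespace FreeGC

/-- Graded commutativity `s t = (-1)^(|s||t|) t s` of the symbols `∂^α g`. -/
inductive Rel (R : Type) [CommRing R] (n : ℕ) {G : Type} (deg : G → ℕ) :
    FreeAlgebra R (G × MultiIndex n) → FreeAlgebra R (G × MultiIndex n) → Prop
  | swap (s t : G × MultiIndex n) : Rel R n deg (FreeAlgebra.ι R s * FreeAlgebra.ι R t)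
      ((-1 : R) ^ (deg s.1 * deg t.1) • (FreeAlgebra.ι R t * FreeAlgebra.ι R s))

end FreeGC

/-- The free graded commutative `R`-algebra on the symbols `∂^α g`, for `g` in a set `G` of
generators with degrees `deg` and `α` a multi-index. The symbol `∂^α g` is the pair `(g, α)` and has
the degree of `g`. As `2` is invertible in `R`, odd elements have square zero.

With `𝒪 = C^∞(ℝⁿ)` and `𝒟` its ring of linear differential operators, the free graded `𝒟`-module `V`
on `G` is the free `𝒪`-module on the symbols `∂^α g`, and this algebra is `R ⊗_𝒪 S_𝒪 V`. -/
def FreeGC (R : Type) [CommRing R] (n : ℕ) {G : Type} (deg : G → ℕ) : Type :=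
  RingQuot (FreeGC.Rel R n deg)

namespace FreeGC

variable {R : Type} [CommRing R] {n : ℕ} {G : Type} {deg : G → ℕ}

noncomputable instance : Ring (FreeGC R n deg) := inferInstanceAs (Ring (RingQuot _))
noncomputable instance : Algebra R (FreeGC R n deg) := inferInstanceAs (Algebra R (RingQuot _))

variable (R n deg) in
/-- The quotient map from the free associative algebra. -/
noncomputable def mk : FreeAlgebra R (G × MultiIndex n) →ₐ[R] FreeGC R n deg :=
  RingQuot.mkAlgHom R (Rel R n deg)

theorem mk_surjective : Function.Surjective (mk R n deg) :=
  RingQuot.mkAlgHom_surjective R (Rel R n deg)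

variable (R deg) in
/-- The generator `∂^α g`, for `s = (g, α)`. -/
noncomputable def gen (s : G × MultiIndex n) : FreeGC R n deg :=
  mk R n deg (FreeAlgebra.ι R s)

theorem gen_swap (s t : G × MultiIndex n) :
    gen R deg s * gen R deg t =
      (-1 : R) ^ (deg s.1 * deg t.1) • (gen R deg t * gen R deg s) := by
  have h : mk R n deg _ = mk R n deg _ :=
    RingQuot.mkAlgHom_rel R (Rel.swap (R := R) (deg := deg) s t)
  rw [map_mul, map_smul, map_mul] at h
  exact h

/-- The universal property. -/
noncomputable def lift {A : Type} [Ring A] [Algebra R A] (f : G × MultiIndex n → A)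
    (hf : ∀ s t, f s * f t = (-1 : R) ^ (deg s.1 * deg t.1) • (f t * f s)) :
    FreeGC R n deg →ₐ[R] A :=
  RingQuot.liftAlgHom R ⟨FreeAlgebra.lift R f, by
    intro x y h
    cases h with
    | swap s t => simp [hf s t]⟩

theorem lift_gen {A : Type} [Ring A] [Algebra R A] (f : G × MultiIndex n → A)
    (hf : ∀ s t, f s * f t = (-1 : R) ^ (deg s.1 * deg t.1) • (f t * f s))
    (s : G × MultiIndex n) : lift f hf (gen R deg s) = f s := by
  have h := RingQuot.liftAlgHom_mkAlgHom_apply R (FreeAlgebra.lift R f) (s := Rel R n deg) (by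
    intro x y h
    cases h with
    | swap s t => simp [hf s t]) (FreeAlgebra.ι R s)
  rw [FreeAlgebra.lift_ι_apply] at h
  exact h

theorem induct {p : FreeGC R n deg → Prop} (h0 : ∀ r : R, p (algebraMap R _ r))
    (hg : ∀ s, p (gen R deg s)) (hm : ∀ x y, p x → p y → p (x * y))
    (ha : ∀ x y, p x → p y → p (x + y)) (x : FreeGC R n deg) : p x := by
  obtain ⟨y, rfl⟩ := mk_surjective x
  induction y using FreeAlgebra.induction with
  | grade0 r => rw [AlgHom.commutes]; exact h0 r
  | grade1 s => exact hg s
  | mul a b h1 h2 => rw [map_mul]; exact hm _ _ h1 h2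
  | add a b h1 h2 => rw [map_add]; exact ha _ _ h1 h2

variable (R deg) in
/-- The elements of degree `m`: combinations of products of generators of total degree `m`. -/
noncomputable def homog (m : ℕ) : Submodule R (FreeGC R n deg) :=
  Submodule.span R {x | ∃ l : List (G × MultiIndex n),
    (l.map fun s => deg s.1).sum = m ∧ x = (l.map (gen R deg)).prod}

theorem gen_mem (s : G × MultiIndex n) : gen R deg s ∈ homog R deg (n := n) (deg s.1) :=
  Submodule.subset_span ⟨[s], by simp, by simp⟩

theorem algebraMap_mem (r : R) : algebraMap R (FreeGC R n deg) r ∈ homog R deg (n := n) 0 := by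
  rw [Algebra.algebraMap_eq_smul_one]
  exact Submodule.smul_mem _ _ (Submodule.subset_span ⟨[], by simp, by simp⟩)

theorem mul_mem {p q : ℕ} {x y : FreeGC R n deg} (hx : x ∈ homog R deg p)
    (hy : y ∈ homog R deg q) : x * y ∈ homog R deg (p + q) := by
  induction hx using Submodule.span_induction with
  | zero => simp
  | add a b _ _ ha hb => rw [add_mul]; exact add_mem ha hb
  | smul c a _ ha => rw [smul_mul_assoc]; exact Submodule.smul_mem _ _ ha
  | mem a ha =>
    obtain ⟨l, rfl, rfl⟩ := ha
    induction hy using Submodule.span_induction with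
    | zero => simp
    | add a b _ _ ha hb => rw [mul_add]; exact add_mem ha hb
    | smul c a _ ha => rw [mul_smul_comm]; exact Submodule.smul_mem _ _ ha
    | mem b hb =>
      obtain ⟨l', rfl, rfl⟩ := hb
      exact Submodule.subset_span ⟨l ++ l', by simp, by simp⟩

theorem gen_mul_list (s : G × MultiIndex n) (l : List (G × MultiIndex n)) :
    gen R deg s * (l.map (gen R deg)).prod =
      (-1 : R) ^ (deg s.1 * (l.map fun s => deg s.1).sum) •
        ((l.map (gen R deg)).prod * gen R deg s) := by
  induction l with
  | nil => simp
  | cons t l ih =>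
    simp only [List.map_cons, List.prod_cons, List.sum_cons]
    rw [← mul_assoc, gen_swap, smul_mul_assoc, mul_assoc, ih, mul_smul_comm, smul_smul,
      mul_add, pow_add, mul_assoc]

/-- Graded commutativity, one factor being a generator. -/
theorem gen_mul_homog (s : G × MultiIndex n) {q : ℕ} {y : FreeGC R n deg}
    (hy : y ∈ homog R deg q) :
    gen R deg s * y = (-1 : R) ^ (deg s.1 * q) • (y * gen R deg s) := by
  induction hy using Submodule.span_induction with
  | zero => simp
  | add a b _ _ ha hb => rw [mul_add, add_mul, ha, hb, smul_add]
  | smul c a _ ha => rw [mul_smul_comm, smul_mul_assoc, ha, smul_comm]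
  | mem b hb =>
    obtain ⟨l, rfl, rfl⟩ := hb
    exact gen_mul_list s l

section maps
variable {G' : Type} {deg' : G' → ℕ}

/-- The algebra map `∂^α g ↦ ∂^α φ(g)` for a degree preserving map `φ` of generators. -/
noncomputable def map (φ : G → G') (hφ : ∀ g, deg' (φ g) = deg g) :
    FreeGC R n deg →ₐ[R] FreeGC R n deg' :=
  lift (fun s => gen R deg' (φ s.1, s.2)) fun s t => by
    rw [gen_swap]; simp only [hφ]

theorem map_mem (φ : G → G') (hφ : ∀ g, deg' (φ g) = deg g) {m : ℕ} {x : FreeGC R n deg}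
    (hx : x ∈ homog R deg m) : map φ hφ x ∈ homog R deg' m := by
  induction hx using Submodule.span_induction with
  | zero => simp
  | add a b _ _ ha hb => rw [map_add]; exact add_mem ha hb
  | smul c a _ ha => rw [map_smul]; exact Submodule.smul_mem _ _ ha
  | mem b hb =>
    obtain ⟨l, rfl, rfl⟩ := hb
    refine Submodule.subset_span ⟨l.map fun s => (φ s.1, s.2), ?_, ?_⟩
    · simp [Function.comp_def, hφ]
    · rw [map_list_prod]
      simp [Function.comp_def, map, lift_gen]

end maps

section pd

/-- The dual numbers `A[ε]`, to be made an `R`-algebra by `r ↦ r + ε Dᵢ r`. -/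
def Twist {n : ℕ} (_i : Fin n) (A : Type) : Type := DualNumber A

noncomputable instance (i : Fin n) (A : Type) [Ring A] : Ring (Twist i A) :=
  inferInstanceAs (Ring (DualNumber A))

variable [Algebra ℝ R] [DRing n R]

/-- The ring map `r ↦ r + ε Dᵢ r`. -/
noncomputable def twistMap (i : Fin n) (A : Type) [Ring A] [Algebra R A] : R →+* Twist i A where
  toFun r := ((algebraMap R A r, algebraMap R A (DRing.der i r)) : A × A)
  map_one' := by
    refine Prod.ext ?_ ?_
    · exact map_one _
    · exact (congrArg (algebraMap R A) (DRing.der (R := R) i).map_one_eq_zero).trans (map_zero _)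
  map_zero' := by
    refine Prod.ext ?_ ?_
    · exact map_zero _
    · exact (congrArg (algebraMap R A) (map_zero _)).trans (map_zero _)
  map_add' a b := by
    refine Prod.ext ?_ ?_
    · exact map_add _ _ _
    · exact (congrArg (algebraMap R A) (map_add _ _ _)).trans (map_add _ _ _)
  map_mul' a b := by
    refine Prod.ext ?_ ?_
    · exact map_mul _ _ _
    · change algebraMap R A _ = algebraMap R A a * algebraMap R A (DRing.der i b) +
        algebraMap R A (DRing.der i a) * algebraMap R A b
      rw [Derivation.leibniz, smul_eq_mul, smul_eq_mul, ← map_mul, ← map_mul, ← map_add,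
        mul_comm b]

noncomputable instance (i : Fin n) (A : Type) [Ring A] [Algebra R A] : Algebra R (Twist i A) :=
  RingHom.toAlgebra' (twistMap i A) fun r x => by
    refine Prod.ext ?_ ?_
    · exact Algebra.commutes r (x : A × A).1
    · change algebraMap R A r * (x : A × A).2 + algebraMap R A (DRing.der i r) * (x : A × A).1 =
        (x : A × A).1 * algebraMap R A (DRing.der i r) + (x : A × A).2 * algebraMap R A r
      rw [Algebra.commutes, Algebra.commutes, add_comm]

variable (R deg) in
/-- The value of `x ↦ x + ε ∂ᵢ x` on a generator, where `∂ᵢ (∂^α g) = ∂^(α + eᵢ) g`. -/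
noncomputable def pdGen (i : Fin n) (s : G × MultiIndex n) : Twist i (FreeGC R n deg) :=
  ((gen R deg s, gen R deg (s.1, s.2 + Finsupp.single i 1)) : FreeGC R n deg × FreeGC R n deg)

theorem pdGen_swap (i : Fin n) (s t : G × MultiIndex n) :
    pdGen R deg i s * pdGen R deg i t =
      (-1 : R) ^ (deg s.1 * deg t.1) • (pdGen R deg i t * pdGen R deg i s) := by
  have h1 := gen_swap (R := R) (deg := deg) s t
  have h2 := gen_swap (R := R) (deg := deg) s (t.1, t.2 + Finsupp.single i 1)
  have h3 := gen_swap (R := R) (deg := deg) (s.1, s.2 + Finsupp.single i 1) t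
  rcases Nat.even_or_odd (deg s.1 * deg t.1) with h | h
  · rw [h.neg_one_pow, one_smul] at *
    refine Prod.ext h1 ?_
    exact (congrArg₂ (· + ·) h2 h3).trans (add_comm _ _)
  · rw [h.neg_one_pow, neg_one_smul] at *
    refine Prod.ext h1 ?_
    exact (congrArg₂ (· + ·) h2 h3).trans ((neg_add _ _).symm.trans
      (congrArg Neg.neg (add_comm _ _)))

/-- The algebra map `x ↦ x + ε ∂ᵢ x`. -/
noncomputable def pdLift (i : Fin n) : FreeGC R n deg →ₐ[R] Twist i (FreeGC R n deg) :=
  lift (pdGen R deg i) (pdGen_swap i)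

/-- The action of `∂ᵢ`: the derivation that extends `Dᵢ` and maps `∂^α g` to `∂^(α + eᵢ) g`
(see `pd_algebraMap`, `pd_gen` and `pd_mul`). -/
noncomputable def pd (i : Fin n) : AddEnd (FreeGC R n deg) where
  toFun x := (pdLift i x : FreeGC R n deg × FreeGC R n deg).2
  map_zero' := by rw [map_zero]; rfl
  map_add' x y := by rw [map_add]; rfl

theorem pd_gen (i : Fin n) (s : G × MultiIndex n) :
    pd i (gen R deg s) = gen R deg (s.1, s.2 + Finsupp.single i 1) :=
  congrArg (fun x : Twist i (FreeGC R n deg) => (x : FreeGC R n deg × FreeGC R n deg).2)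
    (lift_gen (pdGen R deg i) (pdGen_swap i) s)

theorem pd_algebraMap (i : Fin n) (r : R) :
    pd i (algebraMap R (FreeGC R n deg) r) = algebraMap R _ (DRing.der i r) := by
  change (pdLift i (algebraMap R (FreeGC R n deg) r) : FreeGC R n deg × FreeGC R n deg).2 = _
  rw [AlgHom.commutes]
  rfl

theorem pdLift_fst (i : Fin n) (x : FreeGC R n deg) :
    (pdLift i x : FreeGC R n deg × FreeGC R n deg).1 = x := by
  induction x using induct with
  | h0 r => rw [AlgHom.commutes]; rfl
  | hg s => exact congrArg (fun x : Twist i (FreeGC R n deg) =>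
      (x : FreeGC R n deg × FreeGC R n deg).1) (lift_gen (pdGen R deg i) (pdGen_swap i) s)
  | hm x y hx hy =>
    rw [map_mul]
    exact congrArg₂ (· * ·) hx hy
  | ha x y hx hy =>
    rw [map_add]
    exact congrArg₂ (· + ·) hx hy

theorem pd_mul (i : Fin n) (x y : FreeGC R n deg) :
    pd i (x * y) = pd i x * y + x * pd i y := by
  change (pdLift i (x * y) : FreeGC R n deg × FreeGC R n deg).2 = _
  rw [map_mul]
  change (pdLift i x : FreeGC R n deg × FreeGC R n deg).1 * pd i y +
    pd i x * (pdLift i y : FreeGC R n deg × FreeGC R n deg).1 = _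
  rw [pdLift_fst, pdLift_fst, add_comm]

theorem pd_mem (i : Fin n) {m : ℕ} {x : FreeGC R n deg} (hx : x ∈ homog R deg m) :
    pd i x ∈ homog R deg m := by
  have hl (l : List (G × MultiIndex n)) : pd i (l.map (gen R deg)).prod ∈
      homog R deg (l.map fun s => deg s.1).sum := by
    induction l with
    | nil =>
      simp only [List.map_nil, List.prod_nil, List.sum_nil]
      rw [← map_one (algebraMap R (FreeGC R n deg)), pd_algebraMap]
      exact algebraMap_mem _
    | cons s l ih =>
      simp only [List.map_cons, List.prod_cons, List.sum_cons]
      rw [pd_mul, pd_gen]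
      exact add_mem (mul_mem (gen_mem (s.1, s.2 + Finsupp.single i 1))
        (Submodule.subset_span ⟨l, rfl, rfl⟩)) (mul_mem (gen_mem s) ih)
  induction hx using Submodule.span_induction with
  | zero => simp
  | add a b _ _ ha hb => rw [map_add]; exact add_mem ha hb
  | smul c a hx ha =>
    rw [Algebra.smul_def, pd_mul, pd_algebraMap, ← Algebra.smul_def, ← Algebra.smul_def]
    exact add_mem (Submodule.smul_mem _ _ hx) (Submodule.smul_mem _ _ ha)
  | mem b hb =>
    obtain ⟨l, rfl, rfl⟩ := hb
    exact hl l

theorem iterD_mem (α : MultiIndex n) {m : ℕ} {x : FreeGC R n deg} (hx : x ∈ homog R deg m) :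
    iterD pd α x ∈ homog R deg m := by
  have hp (i : Fin n) (k : ℕ) : ∀ y ∈ homog R deg m, (pd i ^ k : AddEnd _) y ∈
      homog (n := n) R deg m := by
    induction k with
    | zero => intro y hy; exact hy
    | succ k ih => intro y hy; rw [pow_succ]; exact ih _ (pd_mem i hy)
  unfold iterD
  induction List.finRange n with
  | nil => exact hx
  | cons i l ih =>
    rw [List.map_cons, List.prod_cons]
    exact hp i _ _ ih

end pd

section differential

variable [Algebra ℝ R] [DRing n R]

variable (n) in
/-- The assignment `δ` on the generators lowers degrees by one (and is zero in degree zero). -/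
def LowersDegree (δ : G → FreeGC R n deg) : Prop :=
  ∀ g, (deg g = 0 → δ g = 0) ∧ ∀ m, deg g = m + 1 → δ g ∈ homog R deg m

/-- The matrix `[(-1)^|x| x, d x; 0, x]` for the generator `x = ∂^α g`, with `d x = ∂^α (δ g)`. -/
noncomputable def dMat (δ : G → FreeGC R n deg) (s : G × MultiIndex n) :
    Matrix (Fin 2) (Fin 2) (FreeGC R n deg) :=
  !![(-1 : R) ^ deg s.1 • gen R deg s, iterD pd s.2 (δ s.1); 0, gen R deg s]

theorem dMat_swap (δ : G → FreeGC R n deg) (hδ : LowersDegree n δ) (s t : G × MultiIndex n) :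
    dMat δ s * dMat δ t = (-1 : R) ^ (deg s.1 * deg t.1) • (dMat δ t * dMat δ s) := by
  have key (s t : G × MultiIndex n) : (-1 : R) ^ deg s.1 • (gen R deg s * iterD pd t.2 (δ t.1)) =
      (-1 : R) ^ (deg s.1 * deg t.1) • (iterD pd t.2 (δ t.1) * gen R deg s) := by
    rcases h : deg t.1 with _ | m
    · rw [(hδ t.1).1 h]; simp
    · rw [gen_mul_homog s (iterD_mem t.2 ((hδ t.1).2 m h)), smul_smul]
      congr 1
      ring
  have key2 : iterD pd s.2 (δ s.1) * gen R deg t =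
      (-1 : R) ^ (deg s.1 * deg t.1) • ((-1 : R) ^ deg t.1 • (gen R deg t * iterD pd s.2 (δ s.1))) := by
    rw [key t s, smul_smul, mul_comm (deg t.1), ← mul_pow]
    simp
  have h1 := gen_swap (R := R) (deg := deg) s t
  unfold dMat
  ext i j
  fin_cases i <;> fin_cases j
  · simp [Matrix.mul_apply]
    rw [h1]
    simp only [smul_smul]
    congr 1
    ring
  · simp [Matrix.mul_apply]
    rw [key s t, key2, add_comm]
  · simp [Matrix.mul_apply]
  · simp [Matrix.mul_apply, h1]

/-- The algebra map `x ↦ [(-1)^|x| x, d x; 0, x]`; multiplicativity of such matrices is the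
graded Leibniz rule `d (x y) = d x * y + (-1)^|x| x * d y`. -/
noncomputable def dLift (δ : G → FreeGC R n deg) (hδ : LowersDegree n δ) :
    FreeGC R n deg →ₐ[R] Matrix (Fin 2) (Fin 2) (FreeGC R n deg) :=
  lift (dMat δ) (dMat_swap δ hδ)

/-- The `R`-linear graded derivation `d` with `d (∂^α g) = ∂^α (δ g)`. -/
noncomputable def diff (δ : G → FreeGC R n deg) (hδ : LowersDegree n δ) :
    FreeGC R n deg →ₗ[R] FreeGC R n deg where
  toFun x := dLift δ hδ x 0 1
  map_add' x y := by rw [map_add]; rfl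
  map_smul' c x := by rw [map_smul]; rfl

theorem diff_gen (δ : G → FreeGC R n deg) (hδ : LowersDegree n δ) (s : G × MultiIndex n) :
    diff δ hδ (gen R deg s) = iterD pd s.2 (δ s.1) := by
  change dLift δ hδ (gen R deg s) 0 1 = _
  rw [dLift, lift_gen]
  rfl

end differential

section aug

variable {B : Type} [CommRing B] [Algebra R B] [Algebra ℝ B] [DRing n B]

/-- The algebra map with `∂^α g ↦ ∂^α (q g)`, into an algebra concentrated in degree zero. -/
noncomputable def aug (q : G → B) (hq : ∀ g, deg g ≠ 0 → q g = 0) : FreeGC R n deg →ₐ[R] B :=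
  lift (fun s => iterD DRing.pd s.2 (q s.1)) fun s t => by
    rcases eq_or_ne (deg s.1) 0 with h | h
    · rw [h, zero_mul, pow_zero, one_smul, mul_comm]
    · rw [hq _ h, map_zero, zero_mul, mul_zero, smul_zero]

theorem aug_gen (q : G → B) (hq : ∀ g, deg g ≠ 0 → q g = 0) (s : G × MultiIndex n) :
    aug (R := R) q hq (gen R deg s) = iterD DRing.pd s.2 (q s.1) :=
  lift_gen _ _ s

end aug

end FreeGC

section Tower

variable (R : Type) [CommRing R] [Algebra ℝ R] (n : ℕ) [DRing n R]
  (B : Type) [CommRing B] [Algebra ℝ B] [Algebra R B] [DRing n B]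

/-- A stage of the small object construction over `R → B`: generators, their degrees, their
differentials, and their values in `B` (zero in positive degree). -/
structure Stage where
  G : Type
  deg : G → ℕ
  δ : G → FreeGC R n deg
  lowers : FreeGC.LowersDegree n δ
  q : G → B
  q_pos : ∀ g, deg g ≠ 0 → q g = 0

namespace Stage

variable {R n B}

/-- The algebra `R ⊗_𝒪 S_𝒪 V` of a stage. -/
abbrev Alg (S : Stage R n B) : Type := FreeGC R n S.deg

/-- The differential of a stage. -/
noncomputable def d (S : Stage R n B) : S.Alg →ₗ[R] S.Alg := FreeGC.diff S.δ S.lowers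

/-- The map of a stage to `B`. -/
noncomputable def aug (S : Stage R n B) : S.Alg →ₐ[R] B := FreeGC.aug S.q S.q_pos

/-- `σ` is a cycle of degree `m` that is mapped to zero in `B`. -/
def IsObstruction (S : Stage R n B) (m : ℕ) (σ : S.Alg) : Prop :=
  σ ∈ FreeGC.homog R S.deg m ∧ S.d σ = 0 ∧ S.aug σ = 0

/-- All pairs `(m, σ)` of a degree `m` and a degree `m` cycle `σ` that is zero in `B`. -/
def Obstruction (S : Stage R n B) : Type := {z : ℕ × S.Alg // S.IsObstruction z.1 z.2}

variable (R n B) in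
/-- The initial stage: a generator `I_f` of degree `0` and differential `0` for each `f ∈ B`,
mapped to `f`. -/
noncomputable def zero : Stage R n B where
  G := B
  deg _ := 0
  δ _ := 0
  lowers _ := ⟨fun _ => rfl, fun _ _ => zero_mem _⟩
  q b := b
  q_pos _ h := absurd rfl h

/-- The degrees in the next stage: a new generator for `(m, σ)` has degree `m + 1`. -/
def nextDeg (S : Stage R n B) : S.G ⊕ S.Obstruction → ℕ :=
  Sum.elim S.deg fun z => z.1.1 + 1

/-- The inclusion of a stage into the next one. -/
noncomputable def inclNext (S : Stage R n B) : S.Alg →ₐ[R] FreeGC R n S.nextDeg :=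
  FreeGC.map Sum.inl fun _ => rfl

/-- The next stage: for each cycle `σ` of the stage that is zero in `B`, a new generator with
differential `σ` and image `0` in `B` is added. -/
noncomputable def next (S : Stage R n B) : Stage R n B where
  G := S.G ⊕ S.Obstruction
  deg := S.nextDeg
  δ := Sum.elim (fun g => S.inclNext (S.δ g)) fun z => S.inclNext z.1.2
  lowers := by
    rintro (g | z)
    · refine ⟨fun h => ?_, fun m h => FreeGC.map_mem _ _ ((S.lowers g).2 m h)⟩
      simp only [Sum.elim_inl]
      rw [(S.lowers g).1 h, map_zero]
    · refine ⟨fun h => absurd h (Nat.succ_ne_zero _), fun m h => ?_⟩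
      obtain rfl : z.1.1 = m := Nat.succ_injective h
      exact FreeGC.map_mem _ _ z.2.1
  q := Sum.elim S.q fun _ => 0
  q_pos := by
    rintro (g | z) h
    · exact S.q_pos g h
    · rfl

end Stage

/-- The stages of the small object construction. -/
noncomputable def tower : ℕ → Stage R n B
  | 0 => Stage.zero R n B
  | k + 1 => (tower k).next

/-- The generators that are new in stage `k`. -/
def NewGen : ℕ → Type
  | 0 => B
  | k + 1 => (tower R n B k).Obstruction

/-- All generators of all stages. -/
def CofGen : Type := Σ k, NewGen R n B k

variable {B}

/-- The generator `I_f`. -/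
def CofGen.I (f : B) : CofGen R n B := ⟨0, f⟩

variable {R n}

/-- The generator `I^(k+1)_(σ,0)`, added to stage `k` on account of the degree `m` cycle `σ` of that
stage that is zero in `B`. -/
def CofGen.J (k : ℕ) (m : ℕ) (σ : (tower R n B k).Alg)
    (h : (tower R n B k).IsObstruction m σ) : CofGen R n B := ⟨k + 1, ⟨(m, σ), h⟩⟩

variable (R n B)

/-- The degrees of the generators: `0` for `I_f`, and `m + 1` for `I^(k+1)_(σ,0)` with `|σ| = m`. -/
def cofDeg : CofGen R n B → ℕ
  | ⟨0, _⟩ => 0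
  | ⟨_ + 1, z⟩ => z.1.1 + 1

/-- The generators of stage `k` among all generators. -/
noncomputable def towerGen : (k : ℕ) → (tower R n B k).G → CofGen R n B
  | 0, f => CofGen.I R n f
  | k + 1, g => Sum.elim (towerGen k) (fun z => ⟨k + 1, z⟩) g

theorem cofDeg_towerGen : ∀ (k : ℕ) (g : (tower R n B k).G),
    cofDeg R n B (towerGen R n B k g) = (tower R n B k).deg g
  | 0, _ => rfl
  | k + 1, Sum.inl g => cofDeg_towerGen k g
  | _ + 1, Sum.inr _ => rfl

/-- The inclusion of stage `k` into the colimit. -/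
noncomputable def towerIncl (k : ℕ) : (tower R n B k).Alg →ₐ[R] FreeGC R n (cofDeg R n B) :=
  FreeGC.map (towerGen R n B k) (cofDeg_towerGen R n B k)

/-- `d I_f = 0` and `d I^(k+1)_(σ,0) = σ`. -/
noncomputable def cofBdry : CofGen R n B → FreeGC R n (cofDeg R n B)
  | ⟨0, _⟩ => 0
  | ⟨k + 1, z⟩ => towerIncl R n B k z.1.2

theorem cofBdry_lowers : FreeGC.LowersDegree n (cofBdry R n B)
  | ⟨0, _⟩ => ⟨fun _ => rfl, fun _ h => absurd h (Nat.succ_ne_zero _).symm⟩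
  | ⟨_ + 1, z⟩ => ⟨fun h => absurd h (Nat.succ_ne_zero _), fun m h => by
      obtain rfl : z.1.1 = m := Nat.succ_injective h
      exact FreeGC.map_mem _ _ z.2.1⟩

/-- `I_f ↦ f` and `I^(k+1)_(σ,0) ↦ 0`. -/
def cofAugGen : CofGen R n B → B
  | ⟨0, f⟩ => f
  | ⟨_ + 1, _⟩ => 0

theorem cofAugGen_pos : ∀ g, cofDeg R n B g ≠ 0 → cofAugGen R n B g = 0
  | ⟨0, _⟩, h => absurd rfl h
  | ⟨_ + 1, _⟩, _ => rfl

/-- The colimit of the stages: the functorial cofibrant replacement `𝒦𝒯 = R ⊗_𝒪 S_𝒪 𝒱` of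
`R → B`, with `𝒱` the free graded `𝒟`-module on all generators `I_f`, `I^(k+1)_(σ,0)`. -/
abbrev Cof : Type := FreeGC R n (cofDeg R n B)

/-- The differential of `𝒦𝒯`. -/
noncomputable def cofDiff : Cof R n B →ₗ[R] Cof R n B :=
  FreeGC.diff (cofBdry R n B) (cofBdry_lowers R n B)

/-- The augmentation `𝒦𝒯 → B`. -/
noncomputable def cofAug : Cof R n B →ₐ[R] B :=
  FreeGC.aug (cofAugGen R n B) (cofAugGen_pos R n B)

end Tower

end KoszulTate

namespace KoszulTate
open scoped ContDiff

/-- The infinite jet space of the trivial bundle `ℝⁿ × ℝʳ → ℝⁿ`: points `(x^i, u^a_α)`. -/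
abbrev Jet (n r : ℕ) : Type := (Fin n → ℝ) × (Fin r × MultiIndex n → ℝ)

variable {n r : ℕ}

/-- Projection to finitely many coordinates. -/
def Jet.proj (s : Finset (Fin r × MultiIndex n)) (p : Jet n r) : (Fin n → ℝ) × (s → ℝ) :=
  (p.1, fun c => p.2 c)

/-- `f` is a smooth function of `x` and of the coordinates `u^a_α`, `(a, α) ∈ s`. -/
def SmoothIn (s : Finset (Fin r × MultiIndex n)) (f : Jet n r → ℝ) : Prop :=
  ∃ g : (Fin n → ℝ) × (s → ℝ) → ℝ, ContDiff ℝ ∞ g ∧ ∀ p, f p = g (Jet.proj s p)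

theorem SmoothIn.mono {s t : Finset (Fin r × MultiIndex n)} (h : s ⊆ t) {f : Jet n r → ℝ}
    (hf : SmoothIn s f) : SmoothIn t f := by
  obtain ⟨g, hg, hfg⟩ := hf
  refine ⟨fun y => g (y.1, fun c => y.2 ⟨c, h c.2⟩), hg.comp ?_, fun p => hfg p⟩
  fun_prop

theorem SmoothIn.hasLineDerivAt {s : Finset (Fin r × MultiIndex n)} {f : Jet n r → ℝ}
    {g : (Fin n → ℝ) × (s → ℝ) → ℝ} (hg : ContDiff ℝ ∞ g) (hfg : ∀ p, f p = g (Jet.proj s p))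
    (p v : Jet n r) : HasLineDerivAt ℝ f (fderiv ℝ g (Jet.proj s p) (Jet.proj s v)) p v := by
  have h := ((hg.differentiable (by simp)) (Jet.proj s p)).hasFDerivAt.hasLineDerivAt (Jet.proj s v)
  unfold HasLineDerivAt at *
  have e : (fun t : ℝ => f (p + t • v)) = fun t : ℝ => g (Jet.proj s p + t • Jet.proj s v) := by
    funext t
    rw [hfg]
    rfl
  rw [e]
  exact h

/-- The smooth functions of finitely many jet coordinates. -/
def jetFunctions (n r : ℕ) : Subalgebra ℝ (Jet n r → ℝ) where
  carrier := {f | ∃ s, SmoothIn s f}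
  mul_mem' := by
    classical
    rintro f f' ⟨s, hf⟩ ⟨t, hf'⟩
    obtain ⟨g, hg, hfg⟩ := hf.mono (t := s ∪ t) Finset.subset_union_left
    obtain ⟨g', hg', hfg'⟩ := hf'.mono (t := s ∪ t) Finset.subset_union_right
    exact ⟨s ∪ t, fun y => g y * g' y, hg.mul hg', fun p => by simp [hfg, hfg']⟩
  add_mem' := by
    classical
    rintro f f' ⟨s, hf⟩ ⟨t, hf'⟩
    obtain ⟨g, hg, hfg⟩ := hf.mono (t := s ∪ t) Finset.subset_union_left
    obtain ⟨g', hg', hfg'⟩ := hf'.mono (t := s ∪ t) Finset.subset_union_right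
    exact ⟨s ∪ t, fun y => g y + g' y, hg.add hg', fun p => by simp [hfg, hfg']⟩
  algebraMap_mem' c := ⟨∅, fun _ => c, contDiff_const, fun _ => rfl⟩

/-- The algebra `ℱ` of functions of the infinite jet space. -/
def JetFun (n r : ℕ) : Type := jetFunctions n r

instance : CommRing (JetFun n r) := inferInstanceAs (CommRing (jetFunctions n r))
instance : Algebra ℝ (JetFun n r) := inferInstanceAs (Algebra ℝ (jetFunctions n r))
instance : Nontrivial (JetFun n r) := inferInstanceAs (Nontrivial (jetFunctions n r))

theorem JetFun.lineDifferentiableAt (f : JetFun n r) (p v : Jet n r) :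
    LineDifferentiableAt ℝ f.1 p v := by
  obtain ⟨s, g, hg, hfg⟩ := f.2
  exact (SmoothIn.hasLineDerivAt hg hfg p v).lineDifferentiableAt

theorem lineDeriv_mul_jet (f g : JetFun n r) (p v : Jet n r) :
    lineDeriv ℝ (f.1 * g.1) p v = f.1 p * lineDeriv ℝ g.1 p v + g.1 p * lineDeriv ℝ f.1 p v := by
  have h := HasDerivAt.mul (f.lineDifferentiableAt p v).hasLineDerivAt
    (g.lineDifferentiableAt p v).hasLineDerivAt
  simp only [zero_smul, add_zero] at h
  refine (show lineDeriv ℝ (f.1 * g.1) p v = _ from h.deriv).trans ?_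
  ring

theorem lineDeriv_add_jet (f g : JetFun n r) (p v : Jet n r) :
    lineDeriv ℝ (f.1 + g.1) p v = lineDeriv ℝ f.1 p v + lineDeriv ℝ g.1 p v :=
  HasLineDerivAt.lineDeriv (HasDerivAt.add (f.lineDifferentiableAt p v).hasLineDerivAt
    (g.lineDifferentiableAt p v).hasLineDerivAt)

theorem lineDeriv_smul_jet (c : ℝ) (f : JetFun n r) (p v : Jet n r) :
    lineDeriv ℝ (c • f.1) p v = c • lineDeriv ℝ f.1 p v :=
  HasLineDerivAt.lineDeriv (HasDerivAt.const_smul c (f.lineDifferentiableAt p v).hasLineDerivAt)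

/-- The vector `D_{x^i} = ∂_{x^i} + ∑ u^a_(α + eᵢ) ∂_{u^a_α}` at `p`. -/
noncomputable def Jet.cartan (i : Fin n) (p : Jet n r) : Jet n r :=
  (Pi.single i 1, fun c => p.2 (c.1, c.2 + Finsupp.single i 1))

theorem cartan_mem (i : Fin n) (f : JetFun n r) :
    (fun p => lineDeriv ℝ f.1 p (Jet.cartan i p)) ∈ jetFunctions n r := by
  classical
  obtain ⟨s, hf⟩ := f.2
  obtain ⟨g, hg, hfg⟩ := hf
  let t : Finset (Fin r × MultiIndex n) :=
    s ∪ s.image fun c => (c.1, c.2 + Finsupp.single i 1)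
  have h1 : ∀ c : s, c.1 ∈ t := fun c => Finset.mem_union_left _ c.2
  have h2 : ∀ c : s, (c.1.1, c.1.2 + Finsupp.single i 1) ∈ t := fun c =>
    Finset.mem_union_right _ (Finset.mem_image_of_mem _ c.2)
  refine ⟨t, fun y => fderiv ℝ g (y.1, fun c => y.2 ⟨c, h1 c⟩)
    ((Pi.single i 1, fun c => y.2 ⟨_, h2 c⟩) : (Fin n → ℝ) × (s → ℝ)), ?_, fun p => ?_⟩
  · refine ContDiff.clm_apply ?_ (by fun_prop)
    exact (hg.fderiv_right (m := ∞) (by simp)).comp (by fun_prop)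
  · exact (SmoothIn.hasLineDerivAt hg hfg p _).lineDeriv

/-- The total derivative `D_{x^i}` of `ℱ`. -/
noncomputable def totalDerivative (i : Fin n) : Derivation ℝ (JetFun n r) (JetFun n r) :=
  Derivation.mk'
    { toFun := fun f => ⟨fun p => lineDeriv ℝ f.1 p (Jet.cartan i p), cartan_mem i f⟩
      map_add' := fun f g => Subtype.ext (funext fun p => lineDeriv_add_jet f g p _)
      map_smul' := fun c f => Subtype.ext (funext fun p => lineDeriv_smul_jet c f p _) }
    fun f g => Subtype.ext (funext fun p => lineDeriv_mul_jet f g p _)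

noncomputable instance : DRing n (JetFun n r) := ⟨totalDerivative⟩

theorem vertical_mem (c : Fin r × MultiIndex n) (f : JetFun n r) :
    (fun p => lineDeriv ℝ f.1 p ((0, Pi.single c 1) : Jet n r)) ∈ jetFunctions n r := by
  obtain ⟨s, g, hg, hfg⟩ := f.2
  refine ⟨s, fun y => fderiv ℝ g y (Jet.proj s (0, Pi.single c 1)), ?_, fun p => ?_⟩
  · exact ContDiff.clm_apply (hg.fderiv_right (m := ∞) (by simp)) contDiff_const
  · exact (SmoothIn.hasLineDerivAt hg hfg p _).lineDeriv

/-- `∂f / ∂u^a_α` for `c = (a, α)`. -/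
noncomputable def verticalDerivative (c : Fin r × MultiIndex n) (f : JetFun n r) : JetFun n r :=
  ⟨fun p => lineDeriv ℝ f.1 p (0, Pi.single c 1), vertical_mem c f⟩

/-- `f` is a function of the `k`-jet space. -/
def HasOrder (k : ℕ) (f : JetFun n r) : Prop :=
  ∃ s : Finset (Fin r × MultiIndex n), (∀ c ∈ s, c.2.degree ≤ k) ∧ SmoothIn s f.1

/-- `δ_{u^a} L = ∑_α (-D_x)^α ∂_{u^a_α} L` (a finite sum). -/
noncomputable def eulerLagrange (L : JetFun n r) (a : Fin r) : JetFun n r :=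
  ∑ᶠ α : MultiIndex n, (-1) ^ α.degree * iterD DRing.pd α (verticalDerivative (a, α) L)

end KoszulTate

namespace KoszulTate
open scoped ContDiff

variable {n r : ℕ}

theorem finite_degree_le (k : ℕ) :
    {c : Fin r × MultiIndex n | c.2.degree ≤ k}.Finite := by
  have h : {α : MultiIndex n | α.degree ≤ k}.Finite := by
    refine (Set.Finite.subset (Set.finite_Iic (Finsupp.equivFunOnFinite.symm fun _ : Fin n => k))
      fun α hα => ?_)
    intro i
    exact (Finsupp.le_degree i α).trans hα
  exact (Set.finite_univ.prod h).subset fun c hc => ⟨trivial, hc⟩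

/-- The coordinates `u^a_α` with `|α| ≤ k`. -/
noncomputable def coords (n r k : ℕ) : Finset (Fin r × MultiIndex n) :=
  (finite_degree_le k).toFinset

theorem mem_coords {k : ℕ} {c : Fin r × MultiIndex n} : c ∈ coords n r k ↔ c.2.degree ≤ k := by
  simp [coords]

theorem HasOrder.smoothIn {k : ℕ} {f : JetFun n r} (h : HasOrder k f) :
    SmoothIn (coords n r k) f.1 := by
  obtain ⟨s, hs, hf⟩ := h
  exact hf.mono fun c hc => mem_coords.2 (hs c hc)

theorem hasOrder_of_smoothIn {k : ℕ} {f : JetFun n r} (h : SmoothIn (coords n r k) f.1) :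
    HasOrder k f := ⟨_, fun _ hc => mem_coords.1 hc, h⟩

theorem exists_hasOrder (f : JetFun n r) : ∃ m, HasOrder m f := by
  obtain ⟨s, hf⟩ := f.2
  exact ⟨s.sup fun c => c.2.degree, s, fun c hc => Finset.le_sup (f := fun c => c.2.degree) hc, hf⟩

theorem HasOrder.mono {k m : ℕ} (h : k ≤ m) {f : JetFun n r} (hf : HasOrder k f) :
    HasOrder m f := by
  obtain ⟨s, hs, hf⟩ := hf
  exact ⟨s, fun c hc => (hs c hc).trans h, hf⟩

theorem HasOrder.total {k : ℕ} {f : JetFun n r} (hf : HasOrder k f) (i : Fin n) :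
    HasOrder (k + 1) (DRing.pd i f) := by
  classical
  obtain ⟨s, hs, g, hg, hfg⟩ := hf
  let t : Finset (Fin r × MultiIndex n) :=
    s ∪ s.image fun c => (c.1, c.2 + Finsupp.single i 1)
  have h1 : ∀ c : s, c.1 ∈ t := fun c => Finset.mem_union_left _ c.2
  have h2 : ∀ c : s, (c.1.1, c.1.2 + Finsupp.single i 1) ∈ t := fun c =>
    Finset.mem_union_right _ (Finset.mem_image_of_mem _ c.2)
  refine ⟨t, ?_, fun y => fderiv ℝ g (y.1, fun c => y.2 ⟨c, h1 c⟩)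
    ((Pi.single i 1, fun c => y.2 ⟨_, h2 c⟩) : (Fin n → ℝ) × (s → ℝ)), ?_, fun p => ?_⟩
  · intro c hc
    rcases Finset.mem_union.1 hc with hc | hc
    · exact (hs c hc).trans (Nat.le_succ _)
    · obtain ⟨c', hc', rfl⟩ := Finset.mem_image.1 hc
      simpa using hs c' hc'
  · refine ContDiff.clm_apply ?_ (by fun_prop)
    exact (hg.fderiv_right (m := ∞) (by simp)).comp (by fun_prop)
  · exact (SmoothIn.hasLineDerivAt hg hfg p _).lineDeriv

theorem HasOrder.total_pow {k : ℕ} {f : JetFun n r} (hf : HasOrder k f) (i : Fin n) (m : ℕ) :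
    HasOrder (k + m) ((DRing.pd i ^ m : AddEnd (JetFun n r)) f) := by
  induction m with
  | zero => exact hf
  | succ m ih => rw [pow_succ']; exact ih.total i

theorem HasOrder.iterD {k : ℕ} {f : JetFun n r} (hf : HasOrder k f) (α : MultiIndex n) :
    HasOrder (k + α.degree) (KoszulTate.iterD DRing.pd α f) := by
  have e : α.degree = ((List.finRange n).map α).sum := by
    rw [Finsupp.degree_eq_sum, Fin.sum_univ_def]
  rw [e]
  unfold KoszulTate.iterD
  induction List.finRange n with
  | nil => exact hf
  | cons i l ih =>
    simp only [List.map_cons, List.prod_cons, List.sum_cons]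
    rw [add_comm (α i), ← add_assoc]
    exact ih.total_pow i _

/-- `p` and `q` have the same `k`-jet. -/
def AgreeTo (k : ℕ) (p q : Jet n r) : Prop :=
  p.1 = q.1 ∧ ∀ c, c.2.degree ≤ k → p.2 c = q.2 c

theorem HasOrder.congr {k : ℕ} {f : JetFun n r} (hf : HasOrder k f) {p q : Jet n r}
    (h : AgreeTo k p q) : f.1 p = f.1 q := by
  obtain ⟨s, hs, g, -, hfg⟩ := hf
  rw [hfg, hfg]
  congr 1
  exact Prod.ext h.1 (funext fun c => h.2 c (hs c c.2))

/-- The `l`-th prolongation of the equation `E = 0`: all `D^α E_a` with `|α| ≤ l` vanish. -/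
def shellAt (E : Fin r → JetFun n r) (l : ℕ) : Set (Jet n r) :=
  {p | ∀ a, ∀ α : MultiIndex n, α.degree ≤ l → (iterD DRing.pd α (E a)).1 p = 0}

/-- The infinite prolongation `Σ` of the equation `E = 0`: all `D^α E_a` vanish. -/
def shell (E : Fin r → JetFun n r) : Set (Jet n r) :=
  {p | ∀ a, ∀ α : MultiIndex n, (iterD DRing.pd α (E a)).1 p = 0}

/-- Formal integrability of an equation `E = 0` of order `k`: the `(k+l)`-jet of a point of the
`l`-th prolongation is the `(k+l)`-jet of a point of the next prolongation. -/
def FormallyIntegrable (k : ℕ) (E : Fin r → JetFun n r) : Prop :=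
  ∀ l, ∀ p ∈ shellAt E l, ∃ q ∈ shellAt E (l + 1), AgreeTo (k + l) p q

/-- The ideal of the functions that vanish on `S`. -/
def vanishingIdeal (S : Set (Jet n r)) : Ideal (JetFun n r) where
  carrier := {f | ∀ p ∈ S, f.1 p = 0}
  zero_mem' _ _ := rfl
  add_mem' {f g} hf hg p hp := by
    change f.1 p + g.1 p = 0
    rw [hf p hp, hg p hp, add_zero]
  smul_mem' c f hf p hp := by
    change c.1 p * f.1 p = 0
    rw [hf p hp, mul_zero]

/-- A finite order solution extends to a point of `Σ`. -/
theorem exists_lift {k : ℕ} {E : Fin r → JetFun n r} (hk : ∀ a, HasOrder k (E a))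
    (hE : FormallyIntegrable k E) (l : ℕ) (p : Jet n r) (hp : p ∈ shellAt E l) :
    ∃ q ∈ shell E, AgreeTo (k + l) p q := by
  choose! nxt h1 h2 using hE
  let P : ℕ → Jet n r := fun j => Nat.rec p (fun j x => nxt (l + j) x) j
  have hP : ∀ j, P j ∈ shellAt E (l + j) := by
    intro j
    induction j with
    | zero => exact hp
    | succ j ih => exact h1 _ _ ih
  have hs : ∀ j, AgreeTo (k + (l + j)) (P j) (P (j + 1)) := fun j => h2 _ _ (hP j)
  have hm : ∀ i j, i ≤ j → AgreeTo (k + (l + i)) (P i) (P j) := by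
    intro i j hij
    induction j, hij using Nat.le_induction with
    | base => exact ⟨rfl, fun _ _ => rfl⟩
    | succ j hij ih =>
      exact ⟨ih.1.trans (hs j).1, fun c hc => (ih.2 c hc).trans ((hs j).2 c (by omega))⟩
  let q : Jet n r := (p.1, fun c => (P c.2.degree).2 c)
  have hq : ∀ j, AgreeTo (k + (l + j)) (P j) q := by
    intro j
    refine ⟨((hm 0 j (Nat.zero_le _)).1).symm, fun c hc => ?_⟩
    rcases le_total j c.2.degree with h | h
    · exact (hm j _ h).2 c hc
    · exact ((hm _ j h).2 c (by omega)).symm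
  refine ⟨q, fun a α => ?_, hq 0⟩
  rw [← (((hk a).iterD α).congr (p := P α.degree) (q := q) ?_)]
  · exact hP _ a α (by omega)
  · exact ⟨(hq _).1, fun c hc => (hq α.degree).2 c (by omega)⟩

end KoszulTate

namespace KoszulTate
open scoped ContDiff
variable {n r : ℕ}

/-- If finitely many functions have independent vertical differentials at `p`, a function that
vanishes on their zero locus has derivative zero in each direction in which theirs are zero. -/
theorem lineDeriv_eq_zero {m : ℕ} {ι : Type} [Finite ι] (E : ι → JetFun n r)
    (hE : ∀ i, HasOrder m (E i)) (f : JetFun n r) (hf : HasOrder m f) (p : Jet n r)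
    (hp : ∀ i, (E i).1 p = 0) (hfE : ∀ q, (∀ i, (E i).1 q = 0) → f.1 q = 0)
    (hind : LinearIndependent ℝ fun i c => (verticalDerivative c (E i)).1 p)
    (v : Jet n r) (hv : ∀ i, lineDeriv ℝ (E i).1 p v = 0) : lineDeriv ℝ f.1 p v = 0 := by
  classical
  have := Fintype.ofFinite ι
  let s := coords n r m
  choose g hg hgE using fun i => (hE i).smoothIn
  obtain ⟨φ, hφ, hfφ⟩ := hf.smoothIn
  let ext : (Fin n → ℝ) × (s → ℝ) → Jet n r := fun y =>
    (y.1, fun c => if h : c ∈ s then y.2 ⟨c, h⟩ else 0)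
  have hext : ∀ y, Jet.proj s (ext y) = y := by
    intro y
    refine Prod.ext rfl (funext fun c => ?_)
    simp [ext, Jet.proj]
  let x := Jet.proj s p
  have hloc : IsLocalExtrOn φ {y | ∀ i, g i y = g i x} x := by
    refine Or.inl ?_
    filter_upwards [self_mem_nhdsWithin] with y hy
    have h0 : ∀ q, (∀ i, (E i).1 q = 0) → φ (Jet.proj s q) = 0 := fun q hq => by
      rw [← hfφ]; exact hfE q hq
    rw [h0 p hp]
    have := h0 (ext y) fun i => by
      rw [hgE i, hext, hy i]
      exact (hgE i p).symm.trans (hp i)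
    rw [hext] at this
    rw [this]
  obtain ⟨Λ, Λ₀, hne, hsum⟩ := hloc.exists_multipliers_of_hasStrictFDerivAt
    (fun i => (hg i).contDiffAt.hasStrictFDerivAt (by simp))
    (hφ.contDiffAt.hasStrictFDerivAt (by simp))
  have key : ∀ w : Jet n r, ∑ i, Λ i * lineDeriv ℝ (E i).1 p w + Λ₀ * lineDeriv ℝ f.1 p w = 0 := by
    intro w
    have := congrArg (fun T => T (Jet.proj s w)) hsum
    simp only [add_apply, sum_apply,
      smul_apply, smul_eq_mul, zero_apply] at this
    rw [(SmoothIn.hasLineDerivAt hφ hfφ p w).lineDeriv]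
    simp only [fun i => (SmoothIn.hasLineDerivAt (hg i) (hgE i) p w).lineDeriv]
    exact this
  have hΛ₀ : Λ₀ ≠ 0 := by
    rintro rfl
    apply hne
    have : Λ = 0 := by
      funext i
      refine (Fintype.linearIndependent_iff.1 hind) Λ ?_ i
      funext c
      have := key (0, Pi.single c 1)
      simp only [zero_mul, add_zero] at this
      simpa [verticalDerivative] using this
    rw [this]; rfl
  have := key v
  simp only [hv, mul_zero, Finset.sum_const_zero, zero_add] at this
  exact (mul_eq_zero.1 this).resolve_left hΛ₀
end KoszulTate

namespace KoszulTate
open scoped ContDiff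
variable {n r : ℕ}

theorem hasDerivAt_fderiv_line {V : Type} [NormedAddCommGroup V] [NormedSpace ℝ V] {g : V → ℝ}
    (hg : ContDiff ℝ ∞ g) (a b c d : V) :
    HasDerivAt (fun t : ℝ => fderiv ℝ g (a + t • b) (c + t • d))
      (fderiv ℝ (fderiv ℝ g) a b c + fderiv ℝ g a d) 0 := by
  have hl : ∀ a b : V, HasDerivAt (fun t : ℝ => a + t • b) b 0 := fun a b => by
    simpa using ((hasDerivAt_id (0 : ℝ)).smul_const b).const_add a
  have hd : HasFDerivAt (fderiv ℝ g) (fderiv ℝ (fderiv ℝ g) a) (a + (0 : ℝ) • b) := by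
    rw [zero_smul, add_zero]
    exact (((hg.fderiv_right (m := ∞) (by simp)).differentiable (by simp)) _).hasFDerivAt
  have h2 := hd.comp_hasDerivAt (0 : ℝ) (hl a b)
  have := h2.clm_apply (hl c d)
  simpa using this

theorem total_total (i j : Fin n) (s : Finset (Fin r × MultiIndex n)) (f : JetFun n r)
    (g : (Fin n → ℝ) × (s → ℝ) → ℝ) (hg : ContDiff ℝ ∞ g)
    (hfg : ∀ p, f.1 p = g (Jet.proj s p)) (p : Jet n r) :
    (DRing.pd j (DRing.pd i f)).1 p =
      fderiv ℝ (fderiv ℝ g) (Jet.proj s p) (Jet.proj s (Jet.cartan j p))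
          (Jet.proj s (Jet.cartan i p)) +
        fderiv ℝ g (Jet.proj s p)
          (0, fun c => p.2 (c.1.1, c.1.2 + Finsupp.single i 1 + Finsupp.single j 1)) := by
  have h1 : (DRing.pd i f).1 = fun q => fderiv ℝ g (Jet.proj s q) (Jet.proj s (Jet.cartan i q)) := by
    funext q
    exact (SmoothIn.hasLineDerivAt hg hfg q _).lineDeriv
  refine HasLineDerivAt.lineDeriv (f := (DRing.pd i f).1) ?_
  rw [h1]
  unfold HasLineDerivAt
  let v := Jet.cartan j p
  have e1 : ∀ t : ℝ, Jet.proj s (p + t • v) = Jet.proj s p + t • Jet.proj s v := fun t => rfl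
  have e2 : ∀ t : ℝ, Jet.proj s (Jet.cartan i (p + t • v)) = Jet.proj s (Jet.cartan i p) +
      t • ((0, fun c => p.2 (c.1.1, c.1.2 + Finsupp.single i 1 + Finsupp.single j 1)) :
        (Fin n → ℝ) × (s → ℝ)) := by
    intro t
    refine Prod.ext ?_ (funext fun c => ?_)
    · simp [Jet.proj, Jet.cartan]
    · simp [Jet.proj, Jet.cartan, v]
  change HasDerivAt (fun t : ℝ => fderiv ℝ g (Jet.proj s (p + t • v))
    (Jet.proj s (Jet.cartan i (p + t • v)))) _ 0
  simp only [e1, e2]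
  exact hasDerivAt_fderiv_line hg _ _ _ _

/-- Total derivatives commute. -/
theorem pd_comm (i j : Fin n) (f : JetFun n r) :
    DRing.pd i (DRing.pd j f) = DRing.pd j (DRing.pd i f) := by
  obtain ⟨s, g, hg, hfg⟩ := f.2
  refine Subtype.ext (funext fun p => ?_)
  rw [total_total j i s f g hg hfg, total_total i j s f g hg hfg]
  have hsym : IsSymmSndFDerivAt ℝ g (Jet.proj s p) :=
    hg.contDiffAt.isSymmSndFDerivAt (by simpa [minSmoothness] using
      (WithTop.coe_le_coe.2 le_top : ((2 : ℕ∞) : WithTop ℕ∞) ≤ ∞))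
  rw [hsym]
  simp only [add_right_comm _ (Finsupp.single j 1)]

/-- `∂ᵢ ∘ ∂^α = ∂^(α + eᵢ)` for commuting operators. -/
theorem iterD_add_single {A : Type} [AddCommGroup A] (pd : Fin n → AddEnd A)
    (h : ∀ i j, Commute (pd i) (pd j)) (i : Fin n) (α : MultiIndex n) :
    pd i * iterD pd α = iterD pd (α + Finsupp.single i 1) := by
  have key : ∀ l : List (Fin n), l.Nodup →
      (l.map fun j => pd j ^ ((α + Finsupp.single i 1 : MultiIndex n) j)).prod =
        if i ∈ l then pd i * (l.map fun j => pd j ^ α j).prod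
        else (l.map fun j => pd j ^ α j).prod := by
    intro l hl
    induction l with
    | nil => simp
    | cons j l ih =>
      obtain ⟨hj, hl⟩ := List.nodup_cons.1 hl
      rw [List.map_cons, List.prod_cons, ih hl, List.map_cons, List.prod_cons]
      rcases eq_or_ne i j with rfl | hij
      · simp [hj, pow_succ', mul_assoc]
      · have e : (α + Finsupp.single i 1 : MultiIndex n) j = α j := by simp [hij]
        rw [e]
        simp only [List.mem_cons, hij, false_or]
        split_ifs
        · rw [← mul_assoc, ← mul_assoc, ((h i j).pow_right (α j)).eq]
        · rfl
  have := key (List.finRange n) (List.nodup_finRange n)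
  rw [if_pos (List.mem_finRange i)] at this
  exact this.symm

theorem pd_iterD (i : Fin n) (α : MultiIndex n) (f : JetFun n r) :
    DRing.pd i (iterD DRing.pd α f) = iterD DRing.pd (α + Finsupp.single i 1) f :=
  congrArg (fun T : AddEnd (JetFun n r) => T f)
    (iterD_add_single DRing.pd (fun i j => AddMonoidHom.ext (pd_comm i j)) i α)
end KoszulTate

namespace KoszulTate
open scoped ContDiff
variable {n r : ℕ}

/-- Total differential operators `N = (N^a_α D^α)` with coefficients in `ℱ`, acting on `r`-tuples of
functions; the coefficient `N^a_α` is `N (a, α)`. -/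
abbrev TDO (n r : ℕ) : Type := (Fin r × MultiIndex n) →₀ JetFun n r

/-- `∑ N^a_α D^α E_a`. -/
noncomputable def TDO.eval (E : Fin r → JetFun n r) : TDO n r →ₗ[JetFun n r] JetFun n r :=
  Finsupp.linearCombination (JetFun n r) fun c => iterD DRing.pd c.2 (E c.1)

/-- The composite `D_{x^i} ∘ N`. -/
noncomputable def TDO.total (i : Fin n) : AddEnd (TDO n r) where
  toFun N := N.sum fun c f =>
    Finsupp.single c (DRing.pd i f) + Finsupp.single (c.1, c.2 + Finsupp.single i 1) f
  map_zero' := Finsupp.sum_zero_index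
  map_add' N N' := Finsupp.sum_add_index' (fun c => by simp) fun c f g => by
    rw [map_add, Finsupp.single_add, Finsupp.single_add]
    abel

/-- A regular first-order reducible gauge theory on the trivial bundle `ℝⁿ × ℝʳ → ℝⁿ`. -/
structure RegularGaugeTheory (n r : ℕ) where
  /-- The Lagrangian. -/
  L : JetFun n r
  L_zero : ∀ x : Fin n → ℝ, L.1 (x, 0) = 0
  /-- The order of the Euler-Lagrange equations. -/
  k : ℕ
  order_EL : ∀ a, HasOrder k (eulerLagrange L a)
  integrable : FormallyIntegrable k (eulerLagrange L)
  /-- There is a non-trivial Noether identity `N^a_α D^α δ_{u^a} L = 0`: not all its coefficients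
  vanish on the shell. -/
  gauge : ∃ N : TDO n r, TDO.eval (eulerLagrange L) N = 0 ∧
    ∃ c, N c ∉ vanishingIdeal (shell (eulerLagrange L))
  /-- The index set of the package of independent equations. -/
  I : Type
  /-- The number of generators of the dependent equations. The package of dependent equations is
  indexed by `(δ, β)`, with `δ < K` and `β` a multi-index. -/
  K : ℕ
  /-- The two packages, as combinations of the left hand sides `D^α δ_{u^a} L` by an invertible
  matrix over `ℱ`: a basis of the free module on the formal symbols `D^α δ_{u^a} L`. The equations
  themselves are `E_j = TDO.eval (eulerLagrange L) (M j)`. -/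
  M : Module.Basis (I ⊕ Fin K × MultiIndex n) (JetFun n r) (TDO n r)
  /-- `lev j ≤ l` means that `E_j` belongs to the packages at order `k + l`. -/
  lev : I ⊕ Fin K × MultiIndex n → ℕ
  /-- For each `l`, the matrix relates the packages at order `k + l` and the left hand sides
  `D^α δ_{u^a} L` with `|α| ≤ l`. -/
  span_lev : ∀ l : ℕ, Submodule.span (JetFun n r) (M '' {j | lev j ≤ l}) =
    Submodule.span (JetFun n r)
      ((fun c => Finsupp.single c (1 : JetFun n r)) '' {c | c.2.degree ≤ l})
  order_indep : ∀ b, HasOrder (k + lev (Sum.inl b))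
    (TDO.eval (eulerLagrange L) (M (Sum.inl b)))
  /-- Regularity: the independent equations can locally, at the points of the shell, be used as
  first fibre coordinates of the jet spaces. In other words, the rows `(∂E_b / ∂u^a_α)` of their
  Jacobian matrix in the fibre coordinates are linearly independent at these points. -/
  indep : ∀ p ∈ shell (eulerLagrange L), LinearIndependent ℝ fun (b : I) c =>
    (verticalDerivative c (TDO.eval (eulerLagrange L) (M (Sum.inl b)))).1 p
  /-- The coefficients of the dependent equations `E_Δ = ∑_b F_Δ^b E_b`. -/
  F : Fin K × MultiIndex n → I →₀ JetFun n r
  F_lev : ∀ D b, F D b ≠ 0 → lev (Sum.inl b) ≤ lev (Sum.inr D)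
  F_order : ∀ D b, HasOrder (k + lev (Sum.inr D)) (F D b)
  /-- `E_Δ = ∑_b F_Δ^b E_b`. -/
  dependent : ∀ D, TDO.eval (eulerLagrange L) (M (Sum.inr D)) =
    (F D).sum fun b f => f * TDO.eval (eulerLagrange L) (M (Sum.inl b))
  /-- The dependent equations are total derivatives of `K` of them: `E_(δ,β) = D^β E_(δ,0)`. -/
  derived : ∀ δ β, TDO.eval (eulerLagrange L) (M (Sum.inr (δ, β))) =
    iterD DRing.pd β (TDO.eval (eulerLagrange L) (M (Sum.inr (δ, 0))))
  /-- First-order reducibility. The total derivative `D^β` of the formal Noether identity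
  `E_(δ,0) - ∑_b F_(δ,0)^b E_b = 0` reads `∑_Δ A_(δ,β)^Δ E_Δ + ∑_b c^b E_b = 0`, and the matrix `A`
  is invertible (it is the identity matrix if this is the Noether identity
  `E_(δ,β) - ∑_b F_(δ,β)^b E_b = 0`). -/
  reducibility : Function.Bijective (Finsupp.linearCombination (JetFun n r)
    fun D : Fin K × MultiIndex n => (Finsupp.sumFinsuppEquivProdFinsupp (M.repr
      (iterD TDO.total D.2 (M (Sum.inr (D.1, 0)) -
        (F (D.1, 0)).sum fun b f => f • M (Sum.inl b))))).2)

namespace RegularGaugeTheory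

variable (T : RegularGaugeTheory n r)

/-- The Euler-Lagrange functions `δ_{u^a} L`. -/
noncomputable def EL : Fin r → JetFun n r := eulerLagrange T.L

/-- The ideal `I(Σ)` of the functions that vanish on the shell. -/
def shellIdeal : Ideal (JetFun n r) := vanishingIdeal (shell T.EL)

/-- The Noether operators `R_δ = ∑ R^a_(δα) D^α`: the formal Noether identities
`E_(δ,0) - ∑_b F_(δ,0)^b E_b = 0`, written in terms of the `D^α δ_{u^a} L`. -/
noncomputable def R (δ : Fin T.K) : TDO n r :=
  T.M (Sum.inr (δ, 0)) - (T.F (δ, 0)).sum fun b f => f • T.M (Sum.inl b)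

theorem finite_lev (l : ℕ) : Finite {b : T.I // T.lev (Sum.inl b) ≤ l} := by
  have hli : LinearIndependent (JetFun n r)
      fun j : {j // T.lev j ≤ l} => T.M j.1 := T.M.linearIndependent.comp _ Subtype.val_injective
  have hfin : Module.Finite (JetFun n r)
      (Submodule.span (JetFun n r) (Set.range fun j : {j // T.lev j ≤ l} => T.M j.1)) := by
    have e : Set.range (fun j : {j // T.lev j ≤ l} => T.M j.1) = T.M '' {j | T.lev j ≤ l} := by
      rw [Set.image_eq_range]; rfl
    rw [e, T.span_lev]
    exact Module.Finite.span_of_finite _ ((finite_degree_le l).image _)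
  have := Module.Finite.finite_basis (Module.Basis.span hli)
  exact Finite.of_injective (fun b : {b : T.I // T.lev (Sum.inl b) ≤ l} =>
    (⟨Sum.inl b.1, b.2⟩ : {j // T.lev j ≤ l})) fun a b h => by
      simpa [Subtype.ext_iff] using h

theorem eval_eq_zero {l : ℕ} {p : Jet n r} (hp : p ∈ shellAt T.EL l) {N : TDO n r}
    (hN : N ∈ Submodule.span (JetFun n r)
      ((fun c => Finsupp.single c (1 : JetFun n r)) '' {c | c.2.degree ≤ l})) :
    (TDO.eval T.EL N).1 p = 0 := by
  induction hN using Submodule.span_induction with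
  | zero => rw [map_zero]; rfl
  | add a b _ _ ha hb =>
    rw [map_add]
    change (TDO.eval T.EL a).1 p + (TDO.eval T.EL b).1 p = 0
    rw [ha, hb, add_zero]
  | smul c a _ ha =>
    rw [map_smul]
    change c.1 p * (TDO.eval T.EL a).1 p = 0
    rw [ha, mul_zero]
  | mem a ha =>
    obtain ⟨c, hc, rfl⟩ := ha
    simp only [TDO.eval, Finsupp.linearCombination_single, one_smul]
    exact hp _ _ hc

theorem pd_eval_eq_zero {p : Jet n r} (hp : p ∈ shell T.EL) (i : Fin n) (N : TDO n r) :
    (DRing.pd i (TDO.eval T.EL N)).1 p = 0 := by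
  induction N using Finsupp.induction_linear with
  | zero => rw [map_zero, map_zero]; rfl
  | add a b ha hb =>
    rw [map_add, map_add]
    change (DRing.pd i (TDO.eval T.EL a)).1 p + (DRing.pd i (TDO.eval T.EL b)).1 p = 0
    rw [ha, hb, add_zero]
  | single c f =>
    simp only [TDO.eval, Finsupp.linearCombination_single]
    have e : DRing.pd i (f • iterD DRing.pd c.2 (T.EL c.1)) =
        f * iterD DRing.pd (c.2 + Finsupp.single i 1) (T.EL c.1) +
          iterD DRing.pd c.2 (T.EL c.1) * DRing.pd i f := by
      rw [← pd_iterD]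
      exact (DRing.der (R := JetFun n r) i).leibniz f _
    rw [e]
    change f.1 p * (iterD DRing.pd (c.2 + Finsupp.single i 1) (T.EL c.1)).1 p +
      (iterD DRing.pd c.2 (T.EL c.1)).1 p * (DRing.pd i f).1 p = 0
    rw [hp, hp, mul_zero, zero_mul, add_zero]

theorem mem_shellAt {l : ℕ} {q : Jet n r}
    (h : ∀ b : {b : T.I // T.lev (Sum.inl b) ≤ l},
      (TDO.eval T.EL (T.M (Sum.inl b.1))).1 q = 0) : q ∈ shellAt T.EL l := by
  have hM : ∀ j, T.lev j ≤ l → (TDO.eval T.EL (T.M j)).1 q = 0 := by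
    rintro (b | D) hj
    · exact h ⟨b, hj⟩
    · have hd : TDO.eval T.EL (T.M (Sum.inr D)) = _ := T.dependent D
      rw [hd]
      let ev : JetFun n r →+* ℝ := (Pi.evalRingHom (fun _ : Jet n r => ℝ) q).comp
        (jetFunctions n r).val.toRingHom
      change ev _ = 0
      rw [Finsupp.sum, map_sum]
      refine Finset.sum_eq_zero fun b hb => ?_
      rw [map_mul]
      have : ev (TDO.eval T.EL (T.M (Sum.inl b))) = 0 :=
        h ⟨b, (T.F_lev D b (Finsupp.mem_support_iff.1 hb)).trans hj⟩
      exact mul_eq_zero_of_right _ this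
  have hs : ∀ N ∈ Submodule.span (JetFun n r) (T.M '' {j | T.lev j ≤ l}),
      (TDO.eval T.EL N).1 q = 0 := by
    intro N hN
    induction hN using Submodule.span_induction with
    | zero => rw [map_zero]; rfl
    | add a b _ _ ha hb =>
      rw [map_add]
      change (TDO.eval T.EL a).1 q + (TDO.eval T.EL b).1 q = 0
      rw [ha, hb, add_zero]
    | smul c a _ ha =>
      rw [map_smul]
      change c.1 q * (TDO.eval T.EL a).1 q = 0
      rw [ha, mul_zero]
    | mem a ha =>
      obtain ⟨j, hj, rfl⟩ := ha
      exact hM j hj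
  intro a α hα
  have := hs (Finsupp.single (a, α) 1) (by
    rw [T.span_lev]
    exact Submodule.subset_span ⟨(a, α), hα, rfl⟩)
  simpa [TDO.eval] using this

/-- `I(Σ)` is stable under total derivatives. -/
theorem pd_mem_shellIdeal (i : Fin n) {f : JetFun n r} (hf : f ∈ T.shellIdeal) :
    DRing.der i f ∈ T.shellIdeal := by
  intro p hp
  obtain ⟨l, hl⟩ := exists_hasOrder f
  have := T.finite_lev l
  refine lineDeriv_eq_zero (m := T.k + l)
    (fun b : {b : T.I // T.lev (Sum.inl b) ≤ l} => TDO.eval T.EL (T.M (Sum.inl b.1)))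
    (fun b => (T.order_indep b.1).mono (by have := b.2; omega)) f (hl.mono (by omega)) p
    (fun b => T.eval_eq_zero (l := l) (fun a α _ => hp a α) ?_) (fun q hq => ?_)
    ((T.indep p hp).comp _ Subtype.val_injective) _ fun b => T.pd_eval_eq_zero hp i _
  · rw [← T.span_lev]
    exact Submodule.subset_span ⟨_, b.2, rfl⟩
  · obtain ⟨q', hq', h⟩ := exists_lift T.order_EL T.integrable l q (T.mem_shellAt hq)
    rw [HasOrder.congr (hl.mono (by omega)) h]
    exact hf q' hq'

/-- The algebra `C^∞(Σ) = ℱ / I(Σ)`. -/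
abbrev ShellFun : Type := JetFun n r ⧸ T.shellIdeal

/-- The derivation of `C^∞(Σ)` induced by the total derivative `D_{x^i}`. -/
noncomputable def shellDer (i : Fin n) : Derivation ℝ T.ShellFun T.ShellFun :=
  Derivation.mk'
    (Submodule.mapQ (T.shellIdeal.restrictScalars ℝ) (T.shellIdeal.restrictScalars ℝ)
      (DRing.der (R := JetFun n r) i).toLinearMap fun _ hf => T.pd_mem_shellIdeal i hf)
    (by
      intro a b
      obtain ⟨a, rfl⟩ := Ideal.Quotient.mk_surjective a
      obtain ⟨b, rfl⟩ := Ideal.Quotient.mk_surjective b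
      exact (congrArg (Ideal.Quotient.mk T.shellIdeal)
        ((DRing.der (R := JetFun n r) i).leibniz a b)))

noncomputable instance : DRing n T.ShellFun := ⟨T.shellDer⟩

/-- The antifields `φ*_a` and `C*_δ` have degrees `1` and `2`. -/
abbrev antifieldDeg : Fin r ⊕ Fin T.K → ℕ := Sum.elim (fun _ => 1) fun _ => 2

/-- The Koszul-Tate chains `KT = ℱ ⊗_𝒪 S_𝒪 V`, with `V` free on the `φ*_a` and `C*_δ`. -/
abbrev KT : Type := FreeGC (JetFun n r) n T.antifieldDeg

/-- The antifield `φ*_a`. -/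
noncomputable def antifield (a : Fin r) : T.KT :=
  FreeGC.gen (JetFun n r) T.antifieldDeg (Sum.inl a, 0)

/-- The antifield `C*_δ`. -/
noncomputable def antifieldC (δ : Fin T.K) : T.KT :=
  FreeGC.gen (JetFun n r) T.antifieldDeg (Sum.inr δ, 0)

/-- `∑ R^a_(δα) (∂^α · φ_a)`. -/
noncomputable def noetherChain {G : Type} {deg : G → ℕ} (φ : Fin r → FreeGC (JetFun n r) n deg)
    (δ : Fin T.K) : FreeGC (JetFun n r) n deg :=
  (T.R δ).sum fun c f => f • iterD FreeGC.pd c.2 (φ c.1)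

/-- `δ_KT φ*_a = δ_{u^a} L` and `δ_KT C*_δ = ∑ R^a_(δα) (∂^α · φ*_a)`. -/
noncomputable def ktBdry : Fin r ⊕ Fin T.K → T.KT :=
  Sum.elim (fun a => algebraMap (JetFun n r) _ (T.EL a))
    (T.noetherChain T.antifield)

theorem ktBdry_lowers : FreeGC.LowersDegree n T.ktBdry
  | Sum.inl _ => ⟨fun h => absurd h one_ne_zero, fun m h => by
      obtain rfl : 0 = m := Nat.succ_injective h
      exact FreeGC.algebraMap_mem _⟩
  | Sum.inr _ => ⟨fun h => absurd h two_ne_zero, fun m h => by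
      obtain rfl : 1 = m := Nat.succ_injective h
      exact Submodule.sum_mem _ fun c _ => Submodule.smul_mem _ _
        (FreeGC.iterD_mem _ (FreeGC.gen_mem (Sum.inl c.1, 0)))⟩

/-- The Koszul-Tate differential. -/
noncomputable def ktDiff : T.KT →ₗ[JetFun n r] T.KT := FreeGC.diff T.ktBdry T.ktBdry_lowers

/-- The cofibrant replacement Koszul-Tate resolution of `ℱ → C^∞(Σ)`. -/
abbrev CofKT : Type := Cof (JetFun n r) n T.ShellFun

end RegularGaugeTheory
end KoszulTate

namespace KoszulTate
section DG
variable (R : Type) [CommRing R] [Algebra ℝ R] (n : ℕ) [DRing n R]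

variable {R n} in
/-- The action of `P = ∑ P_α ∂^α ∈ R[𝒟]`, given the action of the `∂ᵢ`. -/
noncomputable def opAct {A : Type} [AddCommGroup A] [Module R A] (pd : Fin n → AddEnd A)
    (P : MultiIndex n →₀ R) (a : A) : A :=
  P.sum fun α c => c • iterD pd α a

/-- `A`, graded by `gr`, with the action `pd` of the `∂ᵢ` and the differential `d`, is a differential
graded `R[𝒟]`-algebra: a graded commutative `R`-algebra with a `𝒟`-action that extends the one on
`R` and for which vector fields act as degree zero derivations, and with an `R[𝒟]`-linear graded
derivation `d` of degree `-1` and square zero. -/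
structure IsDGJetAlgebra {A : Type} [Ring A] [Algebra R A] (gr : ℕ → Submodule R A)
    (pd : Fin n → AddEnd A) (d : A →ₗ[R] A) : Prop where
  graded : SetLike.GradedMonoid gr
  internal : DirectSum.IsInternal gr
  mul_swap : ∀ p q : ℕ, ∀ a ∈ gr p, ∀ b ∈ gr q, a * b = (-1 : R) ^ (p * q) • (b * a)
  pd_commute : ∀ i j, Commute (pd i) (pd j)
  pd_algebraMap : ∀ i r, pd i (algebraMap R A r) = algebraMap R A (DRing.pd i r)
  pd_mul : ∀ i a b, pd i (a * b) = pd i a * b + a * pd i b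
  pd_mem : ∀ i m, ∀ a ∈ gr m, pd i a ∈ gr m
  d_mem : ∀ m, ∀ a ∈ gr (m + 1), d a ∈ gr m
  d_zero : ∀ a ∈ gr 0, d a = 0
  d_d : ∀ a, d (d a) = 0
  d_mul : ∀ p, ∀ a ∈ gr p, ∀ b, d (a * b) = d a * b + (-1 : R) ^ p • (a * d b)
  d_pd : ∀ i a, d (pd i a) = pd i (d a)

/-- `f` is a morphism of differential graded `R[𝒟]`-algebras: an `R`-algebra map of degree zero that
commutes with the differentials and is `R[𝒟]`-linear. -/
structure IsDGJetHom {A A' : Type} [Ring A] [Algebra R A] [Ring A'] [Algebra R A']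
    (gr : ℕ → Submodule R A) (pd : Fin n → AddEnd A) (d : A →ₗ[R] A)
    (gr' : ℕ → Submodule R A') (pd' : Fin n → AddEnd A') (d' : A' →ₗ[R] A')
    (f : A →ₐ[R] A') : Prop where
  map_mem : ∀ m, ∀ a ∈ gr m, f a ∈ gr' m
  map_d : ∀ a, f (d a) = d' (f a)
  map_op : ∀ (P : MultiIndex n →₀ R) (a : A), f (opAct pd P a) = opAct pd' P (f a)

/-- `q` is a morphism of differential graded `R[𝒟]`-algebras onto `B`, concentrated in degree zero,
that is bijective in homology. -/
structure IsResolution {A : Type} [Ring A] [Algebra R A] (gr : ℕ → Submodule R A)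
    (pd : Fin n → AddEnd A) (d : A →ₗ[R] A)
    {B : Type} [CommRing B] [Algebra ℝ B] [Algebra R B] [DRing n B] (q : A →ₐ[R] B) : Prop where
  map_op : ∀ (P : MultiIndex n →₀ R) (a : A), q (opAct pd P a) = opAct DRing.pd P (q a)
  map_pos : ∀ m, m ≠ 0 → ∀ a ∈ gr m, q a = 0
  map_d : ∀ a, q (d a) = 0
  surjective : ∀ b, ∃ a ∈ gr 0, q a = b
  exact : ∀ m, ∀ a ∈ gr m, d a = 0 → q a = 0 → ∃ c ∈ gr (m + 1), d c = a
end DG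

namespace RegularGaugeTheory
variable {n r : ℕ} (T : RegularGaugeTheory n r)

/-- The differential of the cofibrant replacement. -/
noncomputable def cofDiff : T.CofKT →ₗ[JetFun n r] T.CofKT :=
  KoszulTate.cofDiff (JetFun n r) n T.ShellFun

/-- The augmentation of the cofibrant replacement. -/
noncomputable def cofAug : T.CofKT →ₐ[JetFun n r] T.ShellFun :=
  KoszulTate.cofAug (JetFun n r) n T.ShellFun

/-- The grading of `KT`. -/
noncomputable def ktGrading : ℕ → Submodule (JetFun n r) T.KT :=
  FreeGC.homog (JetFun n r) T.antifieldDeg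

/-- The grading of the cofibrant replacement. -/
noncomputable def cofGrading : ℕ → Submodule (JetFun n r) T.CofKT :=
  FreeGC.homog (JetFun n r) (cofDeg (JetFun n r) n T.ShellFun)

/-- `i` is a morphism of differential graded `ℱ[𝒟]`-algebras. -/
def IsHomKT (i : T.KT →ₐ[JetFun n r] T.CofKT) : Prop :=
  IsDGJetHom (JetFun n r) n T.ktGrading FreeGC.pd T.ktDiff
    T.cofGrading FreeGC.pd T.cofDiff i

/-- A `𝒟`-basis element of `𝒱` as an element of the cofibrant replacement. -/
noncomputable def cofGen (g : CofGen (JetFun n r) n T.ShellFun) : T.CofKT :=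
  FreeGC.gen (JetFun n r) (cofDeg (JetFun n r) n T.ShellFun) (g, 0)

/-- The stages of the cofibrant replacement. -/
noncomputable abbrev stage (k : ℕ) : Stage (JetFun n r) n T.ShellFun := tower (JetFun n r) n T.ShellFun k

/-- `δ_{u^a} L`, as a degree zero element of the initial stage. -/
noncomputable def stageEL (a : Fin r) : (T.stage 0).Alg :=
  algebraMap (JetFun n r) (T.stage 0).Alg (T.EL a)

/-- The generator `I^1_(δ_{u^a} L, 0)` of stage `1`. -/
noncomputable def stageAntifield (h : ∀ a, (T.stage 0).IsObstruction 0 (T.stageEL a)) (a : Fin r) :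
    (T.stage 1).Alg :=
  FreeGC.gen (JetFun n r) (T.stage 1).deg (Sum.inr ⟨(0, T.stageEL a), h a⟩, 0)

/-- `∑ R^a_(δα) (∂^α · I^1_(δ_{u^a} L, 0))`. -/
noncomputable def stageNoether (h : ∀ a, (T.stage 0).IsObstruction 0 (T.stageEL a))
    (δ : Fin T.K) : (T.stage 1).Alg := T.noetherChain (T.stageAntifield h) δ

end RegularGaugeTheory
end KoszulTate

/-! Both complexes are free graded commutative algebras on symbols `∂^α g`, so everything is decided
on generators. A differential is the off-diagonal entry of an algebra map into 2×2 matrices, and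
matrix multiplication gives the signed Leibniz rule (`diff_mul`). It commutes with the `∂ᵢ`, because
it does so on symbols (`diff_pd`), and it squares to zero as soon as the prescribed boundaries of
generators are cycles (`diff_diff`). For `KT` the latter is the Noether identity
(`diff_noetherChain`); for `𝒦𝒯` it is built into the construction.

The resolution property is the small object argument. An element of `𝒦𝒯` involves finitely many
generators, hence comes from a finite stage. Stages embed in the colimit (`towerIncl_injective`), so
a cycle killed by the augmentation is already such a cycle at that stage and is bounded by a
generator of the next (`exists_cofBdry_eq`).

A map of generators that respects degrees and boundaries induces a morphism `KT → 𝒦𝒯`, which is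
injective exactly when the map of generators is (`homOfGens_injective_iff`). Each stage adds a
bounding generator for every cycle again, even one already bounded. Hence equal cycles can be
bounded by distinct generators taken from different stages (`exists_injective_cofBdry_eq`), and an
injective morphism exists even if some `δ_{u^a} L` coincide.

The canonical choice takes the earliest stages, where generators are indexed by the cycles
themselves. Equal Euler-Lagrange functions then share a generator. If they are distinct, the Noether
cycles are distinct too, since their coefficients recover the operators `R_δ`, which differ by
invertibility of the reducibility matrix (`R_injective`). A morphism is unique with given values on
the antifields because the symbols `∂^α g` are obtained from them by the `𝒟`-action. -/

namespace KoszulTate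

/-! ### Iterated operators `∂^α` and their naturality. -/

section iterD

variable {n : ℕ}

theorem multiIndex_induction {p : MultiIndex n → Prop} (h0 : p 0)
    (hs : ∀ α i, p α → p (α + Finsupp.single i 1)) (α : MultiIndex n) : p α := by
  have hm (α : MultiIndex n) (i : Fin n) (b : ℕ) (h : p α) : p (α + Finsupp.single i b) := by
    induction b with
    | zero => simpa using h
    | succ b ih =>
      rw [Finsupp.single_add, ← add_assoc]
      exact hs _ _ ih
  induction α using Finsupp.induction with
  | zero => exact h0
  | single_add i b α _ _ ih => rw [add_comm]; exact hm _ _ _ ih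

theorem iterD_zero {A : Type} [AddCommGroup A] (pd : Fin n → AddEnd A) : iterD pd 0 = 1 := by
  simp [iterD]

theorem iterD_add_single_apply {A : Type} [AddCommGroup A] {pd : Fin n → AddEnd A}
    (h : ∀ i j, Commute (pd i) (pd j)) (i : Fin n) (α : MultiIndex n) (a : A) :
    iterD pd (α + Finsupp.single i 1) a = pd i (iterD pd α a) :=
  (congrArg (fun T : AddEnd A => T a) (iterD_add_single pd h i α)).symm

/-- Only the intertwining with each single operator matters, so `f` is any function-like object.
This covers ring maps, algebra maps and differentials at once. -/
theorem map_iterD {A A' F : Type} [AddCommGroup A] [AddCommGroup A'] [FunLike F A A']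
    {pd : Fin n → AddEnd A} {pd' : Fin n → AddEnd A'} (f : F)
    (h : ∀ i a, f (pd i a) = pd' i (f a)) (α : MultiIndex n) (a : A) :
    f (iterD pd α a) = iterD pd' α (f a) := by
  have hp (i : Fin n) (k : ℕ) (a : A) :
      f ((pd i ^ k : AddEnd A) a) = (pd' i ^ k : AddEnd A') (f a) := by
    induction k generalizing a with
    | zero => rfl
    | succ k ih =>
      rw [pow_succ, pow_succ]
      exact (ih _).trans (congrArg _ (h i a))
  unfold iterD
  induction List.finRange n with
  | nil => rfl
  | cons i l ih =>
    rw [List.map_cons, List.prod_cons, List.map_cons, List.prod_cons]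
    exact (hp i _ _).trans (congrArg _ ih)

theorem map_opAct {R A A' F : Type} [CommRing R] [AddCommGroup A] [AddCommGroup A'] [Module R A]
    [Module R A'] [FunLike F A A'] [LinearMapClass F R A A']
    {pd : Fin n → AddEnd A} {pd' : Fin n → AddEnd A'} (f : F)
    (h : ∀ i a, f (pd i a) = pd' i (f a)) (P : MultiIndex n →₀ R) (a : A) :
    f (opAct pd P a) = opAct pd' P (f a) := by
  simp only [opAct, Finsupp.sum, map_sum, map_smul, map_iterD f h]

theorem opAct_single_one {R A : Type} [CommRing R] [AddCommGroup A] [Module R A]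
    (pd : Fin n → AddEnd A) (α : MultiIndex n) (a : A) :
    opAct pd (Finsupp.single α (1 : R)) a = iterD pd α a := by
  simp [opAct]

end iterD

/-! ### Induction and extensionality for the free graded commutative algebra. -/

namespace FreeGC

variable {R : Type} [CommRing R] {n : ℕ} {G : Type} {deg : G → ℕ}

/-- The signed Leibniz rule needs a homogeneous left factor, so the plain product case of `induct`
is useless for differentials. Here the left factor is always a single generator. The proof shows
that left multiplication by any element preserves `p`. -/
theorem induct_cons {p : FreeGC R n deg → Prop} (h1 : p 1) (hs : ∀ (r : R) x, p x → p (r • x))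
    (hg : ∀ s x, p x → p (gen R deg s * x)) (ha : ∀ x y, p x → p y → p (x + y))
    (x : FreeGC R n deg) : p x := by
  have key : ∀ x y : FreeGC R n deg, p y → p (x * y) := by
    intro x
    induction x using induct with
    | h0 r => intro y hy; rw [← Algebra.smul_def]; exact hs _ _ hy
    | hg s => exact hg s
    | hm a b h1 h2 => intro y hy; rw [mul_assoc]; exact h1 _ (h2 _ hy)
    | ha a b h1 h2 => intro y hy; rw [add_mul]; exact ha _ _ (h1 _ hy) (h2 _ hy)
  simpa using key x 1 h1

theorem algHom_ext {A : Type} [Ring A] [Algebra R A] {f g : FreeGC R n deg →ₐ[R] A}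
    (h : ∀ s, f (gen R deg s) = g (gen R deg s)) : f = g := by
  ext x
  induction x using induct with
  | h0 r => simp
  | hg s => exact h s
  | hm a b h1 h2 => rw [map_mul, map_mul, h1, h2]
  | ha a b h1 h2 => rw [map_add, map_add, h1, h2]

/-! ### Linear coefficients and independence of the generators. -/

section coefficient

open scoped Classical in
/-- The coefficient of the generator `s` in the part of an element that is linear in the
generators. -/
noncomputable def coeff (s : G × MultiIndex n) : FreeGC R n deg →ₗ[R] R :=
  TrivSqZeroExt.sndHom R R ∘ₗ
    -- As `ε² = 0`, every product of two generators goes to zero. This settles all sign conditions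
    -- and leaves the linear part as the coefficient of `ε`.
    (lift (deg := deg) (A := DualNumber R) (fun t => if t = s then DualNumber.eps else 0)
      fun t u => by split_ifs <;> simp).toLinearMap

open scoped Classical in
theorem coeff_gen (s t : G × MultiIndex n) :
    coeff s (gen R deg t) = if t = s then (1 : R) else 0 := by
  change TrivSqZeroExt.snd (lift _ _ (gen R deg t)) = _
  rw [lift_gen]
  split_ifs <;> simp

theorem gen_injective [Nontrivial R] :
    Function.Injective (gen R deg : G × MultiIndex n → FreeGC R n deg) := by
  intro s t h
  by_contra hst
  have := congrArg (coeff s) h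
  rw [coeff_gen, coeff_gen, if_pos rfl, if_neg (Ne.symm hst)] at this
  exact one_ne_zero this

/-- Sending all generators to zero is a retraction onto `R`. -/
theorem algebraMap_injective : Function.Injective (algebraMap R (FreeGC R n deg)) := by
  intro a b h
  have := congrArg (lift (deg := deg) (A := R) (fun _ : G × MultiIndex n => 0) (by simp)) h
  simpa using this

end coefficient

/-! ### The grading and graded commutativity. -/

section grading

instance : SetLike.GradedMonoid (homog R deg (n := n)) where
  one_mem := by simpa using algebraMap_mem (deg := deg) (n := n) (1 : R)
  mul_mem _ _ _ _ ha hb := mul_mem ha hb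

theorem mul_swap (p q : ℕ) (a : FreeGC R n deg) (ha : a ∈ homog R deg p) (b : FreeGC R n deg)
    (hb : b ∈ homog R deg q) : a * b = (-1 : R) ^ (p * q) • (b * a) := by
  induction ha using Submodule.span_induction with
  | zero => simp
  | add x y _ _ hx hy => rw [add_mul, mul_add, hx, hy, smul_add]
  | smul c x _ hx => rw [smul_mul_assoc, mul_smul_comm, hx, smul_comm]
  | mem x hx =>
    obtain ⟨l, rfl, rfl⟩ := hx
    induction l with
    | nil => simp
    | cons s l ih =>
      simp only [List.map_cons, List.prod_cons, List.sum_cons]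
      rw [mul_assoc, ih, mul_smul_comm, ← mul_assoc, gen_mul_homog s hb, smul_mul_assoc, smul_smul,
        mul_assoc, add_mul, pow_add, mul_comm ((-1 : R) ^ _)]

open Polynomial in
variable (R n deg) in
/-- The algebra map that multiplies elements of degree `m` by `X ^ m`. -/
noncomputable def weight : FreeGC R n deg →ₐ[R] (FreeGC R n deg)[X] :=
  lift (fun s => monomial (deg s.1) (gen R deg s)) fun s t => by
    rw [monomial_mul_monomial, monomial_mul_monomial, gen_swap, ← smul_monomial, add_comm]

theorem weight_of_mem {m : ℕ} {x : FreeGC R n deg} (hx : x ∈ homog R deg m) :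
    weight R n deg x = Polynomial.monomial m x := by
  induction hx using Submodule.span_induction with
  | zero => simp
  | add x y _ _ hx hy => rw [map_add, hx, hy, map_add]
  | smul c x _ hx => rw [map_smul, hx, Polynomial.smul_monomial]
  | mem x hx =>
    obtain ⟨l, rfl, rfl⟩ := hx
    induction l with
    | nil => simp
    | cons s l ih =>
      simp only [List.map_cons, List.prod_cons, List.sum_cons]
      rw [map_mul, ih, weight, lift_gen, Polynomial.monomial_mul_monomial]

/-- The map `weight` records the degree as an exponent of `X`, so the homogeneous components of a
sum can be read off as coefficients; this is independence. Spanning holds since monomials are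
homogeneous. -/
theorem isInternal_homog : DirectSum.IsInternal (homog R deg (n := n)) := by
  constructor
  · have key (v : DirectSum ℕ fun m => homog R deg (n := n) m) (m : ℕ) :
        (weight R n deg (DirectSum.coeAddMonoidHom _ v)).coeff m = v m := by
      induction v using DirectSum.induction_on with
      | zero => simp
      | of k x =>
        rw [DirectSum.coeAddMonoidHom_of, weight_of_mem x.2, Polynomial.coeff_monomial]
        split_ifs with h
        · subst h; simp
        · rw [DirectSum.of_eq_of_ne _ _ _ (Ne.symm h)]; rfl
      | add x y hx hy => simp [hx, hy]
    intro v w h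
    refine DFinsupp.ext fun m => Subtype.ext ?_
    have := key v m
    rw [h, key w m] at this
    exact this.symm
  · intro x
    -- The sums of homogeneous elements contain `1` and are stable under scalars, sums and left
    -- multiplication by generators.
    change x ∈ AddMonoidHom.mrange _
    induction x using induct_cons with
    | h1 => exact ⟨DirectSum.of _ 0 ⟨1, SetLike.GradedOne.one_mem⟩, by simp⟩
    | hs r x hx =>
      obtain ⟨v, rfl⟩ := hx
      exact ⟨r • v, map_smul (DirectSum.coeLinearMap (homog R deg (n := n))) r v⟩
    | hg s x hx =>
      obtain ⟨v, rfl⟩ := hx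
      induction v using DirectSum.induction_on with
      | zero => simp
      | of k x =>
        exact ⟨DirectSum.of _ _ ⟨_, mul_mem (gen_mem s) x.2⟩, by simp⟩
      | add x y hx hy => rw [map_add, mul_add]; exact add_mem hx hy
    | ha x y hx hy => exact add_mem hx hy

end grading

/-! ### The `𝒟`-action and the differential. -/

section derivations

variable [Algebra ℝ R] [DRing n R]

theorem pd_smul (i : Fin n) (r : R) (x : FreeGC R n deg) :
    pd i (r • x) = DRing.pd i r • x + r • pd i x := by
  rw [Algebra.smul_def, pd_mul, pd_algebraMap, ← Algebra.smul_def, ← Algebra.smul_def]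
  rfl

theorem pd_one (i : Fin n) : pd i (1 : FreeGC R n deg) = 0 := by
  rw [← map_one (algebraMap R (FreeGC R n deg)), pd_algebraMap, Derivation.map_one_eq_zero, map_zero]

theorem pd_commute (hR : ∀ i j : Fin n, Commute (DRing.pd (R := R) i) (DRing.pd j)) (i j : Fin n) :
    Commute (pd i : AddEnd (FreeGC R n deg)) (pd j) := by
  refine AddMonoidHom.ext fun x => ?_
  change pd i (pd j x) = pd j (pd i x)
  induction x using induct with
  | h0 r =>
    simp only [pd_algebraMap]
    exact congrArg _ (congrArg (fun T : AddEnd R => T r) (hR i j).eq)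
  | hg s => simp only [pd_gen, add_right_comm]
  | hm a b ha hb =>
    simp only [pd_mul, map_add, ha, hb]
    abel
  | ha a b ha hb => simp only [map_add, ha, hb]

/-- The formal symbols `∂^α g` are the actual derivatives of `g`, so that a `𝒟`-linear map is
controlled by its values at `α = 0`. -/
theorem iterD_gen (hR : ∀ i j : Fin n, Commute (DRing.pd (R := R) i) (DRing.pd j))
    (g : G) (α : MultiIndex n) : iterD pd α (gen R deg (g, 0)) = gen R deg (g, α) := by
  induction α using multiIndex_induction with
  | h0 => rw [iterD_zero]; rfl
  | hs α i ih => rw [iterD_add_single_apply (pd_commute hR), ih, pd_gen]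

theorem iterD_algebraMap (α : MultiIndex n) (r : R) :
    iterD pd α (algebraMap R (FreeGC R n deg) r) = algebraMap R _ (iterD DRing.pd α r) :=
  (map_iterD (algebraMap R (FreeGC R n deg)) (fun i r => (pd_algebraMap i r).symm) α r).symm

variable {δ : G → FreeGC R n deg} {hδ : LowersDegree n δ}

theorem dLift_gen (s : G × MultiIndex n) : dLift δ hδ (gen R deg s) = dMat δ s :=
  lift_gen _ _ s

/-- This and the next two lemmas determine the other entries of the matrix `[±x, d x; 0, x]` for
general `x`. It stays upper triangular because the matrices of the generators are. -/
theorem dLift_one_zero (x : FreeGC R n deg) : dLift δ hδ x 1 0 = 0 := by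
  induction x using induct_cons with
  | h1 => simp
  | hs r x hx => rw [map_smul, Matrix.smul_apply, hx, smul_zero]
  | hg s x hx =>
    rw [map_mul, dLift_gen, Matrix.mul_apply, Fin.sum_univ_two, hx]
    simp [dMat]
  | ha x y hx hy => rw [map_add, Matrix.add_apply, hx, hy, add_zero]

theorem dLift_one_one (x : FreeGC R n deg) : dLift δ hδ x 1 1 = x := by
  induction x using induct_cons with
  | h1 => simp
  | hs r x hx => rw [map_smul, Matrix.smul_apply, hx]
  | hg s x hx =>
    rw [map_mul, dLift_gen, Matrix.mul_apply, Fin.sum_univ_two, hx]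
    simp [dMat]
  | ha x y hx hy => rw [map_add, Matrix.add_apply, hx, hy]

theorem dLift_zero_zero {p : ℕ} {x : FreeGC R n deg} (hx : x ∈ homog R deg p) :
    dLift δ hδ x 0 0 = (-1 : R) ^ p • x := by
  induction hx using Submodule.span_induction with
  | zero => simp
  | add x y _ _ hx hy => rw [map_add, Matrix.add_apply, hx, hy, smul_add]
  | smul c x _ hx => rw [map_smul, Matrix.smul_apply, hx, smul_comm]
  | mem x hx =>
    obtain ⟨l, rfl, rfl⟩ := hx
    induction l with
    | nil => simp
    | cons s l ih =>
      simp only [List.map_cons, List.prod_cons, List.sum_cons]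
      rw [map_mul, Matrix.mul_apply, Fin.sum_univ_two, ih, dLift_one_zero, mul_zero, add_zero,
        dLift_gen, mul_smul_comm, pow_add, mul_comm, mul_smul,
        show dMat δ s 0 0 = (-1 : R) ^ deg s.1 • gen R deg s from rfl, smul_mul_assoc]

/-- The upper right entry of a product of upper triangular matrices `[±a, d a; 0, a]` and `[*, d b;
0, b]` is `±a * d b + d a * b`. -/
theorem diff_mul (p : ℕ) (a : FreeGC R n deg) (ha : a ∈ homog R deg p) (b : FreeGC R n deg) :
    diff δ hδ (a * b) = diff δ hδ a * b + (-1 : R) ^ p • (a * diff δ hδ b) := by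
  change dLift δ hδ (a * b) 0 1 = dLift δ hδ a 0 1 * b + _ • (a * dLift δ hδ b 0 1)
  rw [map_mul, Matrix.mul_apply, Fin.sum_univ_two, dLift_zero_zero ha, dLift_one_one,
    smul_mul_assoc, add_comm]

theorem diff_one : diff δ hδ 1 = 0 := by
  change dLift δ hδ 1 0 1 = 0
  simp

theorem diff_algebraMap (r : R) : diff δ hδ (algebraMap R _ r) = 0 := by
  rw [Algebra.algebraMap_eq_smul_one, map_smul, diff_one, smul_zero]

theorem diff_gen_mem (s : G × MultiIndex n) {m : ℕ} (hs : deg s.1 = m + 1) :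
    diff δ hδ (gen R deg s) ∈ homog R deg m := by
  rw [diff_gen]
  exact iterD_mem _ ((hδ s.1).2 m hs)

theorem diff_gen_eq_zero (s : G × MultiIndex n) (hs : deg s.1 = 0) :
    diff δ hδ (gen R deg s) = 0 := by
  rw [diff_gen, (hδ s.1).1 hs, map_zero]

/-- Degree zero and positive degree are treated together, because in the induction on a monomial
either factor may have degree zero while the total degree is positive; the corresponding Leibniz
term then vanishes. -/
theorem diff_mem_or (m : ℕ) {a : FreeGC R n deg} (ha : a ∈ homog R deg m) :
    (m = 0 → diff δ hδ a = 0) ∧ ∀ k, m = k + 1 → diff δ hδ a ∈ homog R deg k := by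
  induction ha using Submodule.span_induction with
  | zero => simp
  | add x y _ _ hx hy =>
    refine ⟨fun h => ?_, fun k h => ?_⟩
    · rw [map_add, hx.1 h, hy.1 h, add_zero]
    · rw [map_add]; exact add_mem (hx.2 k h) (hy.2 k h)
  | smul c x _ hx =>
    refine ⟨fun h => ?_, fun k h => ?_⟩
    · rw [map_smul, hx.1 h, smul_zero]
    · rw [map_smul]; exact Submodule.smul_mem _ _ (hx.2 k h)
  | mem x hx =>
    obtain ⟨l, rfl, rfl⟩ := hx
    induction l with
    | nil => simp [diff_one]
    | cons s l ih =>
      simp only [List.map_cons, List.prod_cons, List.sum_cons]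
      rw [diff_mul _ _ (gen_mem s)]
      have hl : (l.map (gen R deg)).prod ∈ homog R deg (l.map fun s => deg s.1).sum :=
        Submodule.subset_span ⟨l, rfl, rfl⟩
      refine ⟨fun h => ?_, fun k h => add_mem ?_ (Submodule.smul_mem _ _ ?_)⟩
      · rw [diff_gen_eq_zero s (by omega), ih.1 (by omega), zero_mul, mul_zero, smul_zero, add_zero]
      · rcases hs : deg s.1 with _ | j
        · rw [diff_gen_eq_zero s hs, zero_mul]; exact zero_mem _
        · obtain rfl : k = j + (l.map fun s => deg s.1).sum := by omega
          exact mul_mem (diff_gen_mem s hs) hl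
      · rcases hm : (l.map fun s => deg s.1).sum with _ | j
        · rw [ih.1 hm, mul_zero]; exact zero_mem _
        · obtain rfl : k = deg s.1 + j := by omega
          exact mul_mem (gen_mem s) (ih.2 j hm)

theorem diff_mem (m : ℕ) (a : FreeGC R n deg) (ha : a ∈ homog R deg (m + 1)) :
    diff δ hδ a ∈ homog R deg m :=
  (diff_mem_or _ ha).2 m rfl

theorem diff_eq_zero (a : FreeGC R n deg) (ha : a ∈ homog R deg 0) : diff δ hδ a = 0 :=
  (diff_mem_or _ ha).1 rfl

/-- On a symbol, both sides are `∂^(α + eᵢ) (δ g)`. The general case follows by comparing the two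
Leibniz rules, as `∂ᵢ` does not change the degree and hence not the sign. -/
theorem diff_pd (hR : ∀ i j : Fin n, Commute (DRing.pd (R := R) i) (DRing.pd j)) (i : Fin n)
    (a : FreeGC R n deg) : diff δ hδ (pd i a) = pd i (diff δ hδ a) := by
  induction a using induct_cons with
  | h1 => simp [pd_one, diff_one]
  | hs r x hx => rw [pd_smul, map_add, map_smul, map_smul, hx, map_smul, pd_smul]
  | ha x y hx hy => simp only [map_add, hx, hy]
  | hg s x hx =>
    have h1 : diff δ hδ (pd i (gen R deg s)) = pd i (diff δ hδ (gen R deg s)) := by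
      rw [pd_gen, diff_gen, diff_gen]
      exact iterD_add_single_apply (pd_commute hR) i s.2 _
    -- The operator `∂ᵢ` is not `R`-linear, but the scalar here is only `1` or `-1`.
    have h2 : pd i ((-1 : R) ^ deg s.1 • (gen R deg s * diff δ hδ x)) =
        (-1 : R) ^ deg s.1 • pd i (gen R deg s * diff δ hδ x) := by
      rcases neg_one_pow_eq_or R (deg s.1) with h | h <;> simp [h]
    rw [pd_mul, map_add, diff_mul _ _ (pd_mem i (gen_mem s)), diff_mul _ _ (gen_mem s),
      diff_mul _ _ (gen_mem s), map_add, h2, pd_mul, pd_mul, smul_add, h1, hx]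
    abel

/-- The square of an odd derivation is again a derivation, so it suffices that the boundary of each
generator is a cycle; commutation with `∂^α` covers the symbols. -/
theorem diff_diff (hR : ∀ i j : Fin n, Commute (DRing.pd (R := R) i) (DRing.pd j))
    (hdd : ∀ g, diff δ hδ (δ g) = 0) (a : FreeGC R n deg) : diff δ hδ (diff δ hδ a) = 0 := by
  induction a using induct_cons with
  | h1 => simp [diff_one]
  | hs r x hx => rw [map_smul, map_smul, hx, smul_zero]
  | ha x y hx hy => rw [map_add, map_add, hx, hy, add_zero]
  | hg s x hx =>
    have h1 : diff δ hδ (diff δ hδ (gen R deg s)) = 0 := by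
      rw [diff_gen, map_iterD (diff δ hδ) (diff_pd hR), hdd, map_zero]
    rw [diff_mul _ _ (gen_mem s), map_add, map_smul, diff_mul _ _ (gen_mem s), hx]
    rcases hs : deg s.1 with _ | m
    · simp [diff_gen_eq_zero s hs]
    -- Since `d s` has degree `m`, one less than `s`, the two mixed terms `d s * d x` carry opposite
    -- signs and cancel.
    · rw [diff_mul m _ (diff_gen_mem s hs), h1, pow_succ]
      simp

theorem isDGJetAlgebra (hR : ∀ i j : Fin n, Commute (DRing.pd (R := R) i) (DRing.pd j))
    (hdd : ∀ g, diff δ hδ (δ g) = 0) :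
    IsDGJetAlgebra R n (homog R deg) pd (diff δ hδ) where
  graded := inferInstance
  internal := isInternal_homog
  mul_swap := mul_swap
  pd_commute := pd_commute hR
  pd_algebraMap := pd_algebraMap
  pd_mul := pd_mul
  pd_mem i _ _ ha := pd_mem i ha
  d_mem := diff_mem
  d_zero := diff_eq_zero
  d_d := diff_diff hR hdd
  d_mul := diff_mul
  d_pd := diff_pd hR

end derivations

/-! ### Maps induced by generators, and augmentations. -/

section maps

variable {G' G'' : Type} {deg' : G' → ℕ} {deg'' : G'' → ℕ}

theorem map_gen (φ : G → G') (hφ : ∀ g, deg' (φ g) = deg g) (s : G × MultiIndex n) :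
    map (R := R) φ hφ (gen R deg s) = gen R deg' (φ s.1, s.2) :=
  lift_gen _ _ s

theorem map_map (φ : G → G') (hφ : ∀ g, deg' (φ g) = deg g) (ψ : G' → G'')
    (hψ : ∀ g, deg'' (ψ g) = deg' g) (χ : G → G'') (hχ : ∀ g, deg'' (χ g) = deg g)
    (h : ∀ g, ψ (φ g) = χ g) (x : FreeGC R n deg) : map ψ hψ (map φ hφ x) = map χ hχ x := by
  refine DFunLike.congr_fun (f := (map ψ hψ).comp (map φ hφ)) (algHom_ext fun s => ?_) x
  simp only [AlgHom.comp_apply, map_gen, h]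

/-- A left inverse is defined on the target generators by sending those in the image of `φ` back and
all others to zero. Zero commutes with everything up to any sign, and on the image the degrees
match. -/
theorem map_injective (φ : G → G') (hφ : ∀ g, deg' (φ g) = deg g) (hi : Function.Injective φ) :
    Function.Injective (map (R := R) (n := n) φ hφ) := by
  classical
  let f : G' × MultiIndex n → FreeGC R n deg := fun t =>
    if h : ∃ g, φ g = t.1 then gen R deg (h.choose, t.2) else 0
  have hf (s t) : f s * f t = (-1 : R) ^ (deg' s.1 * deg' t.1) • (f t * f s) := by
    dsimp only [f]
    split_ifs with h1 h2
    · rw [gen_swap]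
      congr 3
      · rw [← hφ, h1.choose_spec]
      · rw [← hφ, h2.choose_spec]
    all_goals simp
  have h : (lift f hf).comp (map φ hφ) = AlgHom.id R (FreeGC R n deg) := algHom_ext fun s => by
    have hs : ∃ g, φ g = φ s.1 := ⟨_, rfl⟩
    rw [AlgHom.comp_apply, map_gen, lift_gen, AlgHom.id_apply]
    simp only [f, dif_pos hs, hi hs.choose_spec]
  exact Function.LeftInverse.injective (g := lift f hf) fun x => DFunLike.congr_fun h x

variable {B : Type} [CommRing B] [Algebra R B] [Algebra ℝ B] [DRing n B]

theorem aug_map (φ : G → G') (hφ : ∀ g, deg' (φ g) = deg g) {q : G → B}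
    {hq : ∀ g, deg g ≠ 0 → q g = 0} {q' : G' → B} {hq' : ∀ g, deg' g ≠ 0 → q' g = 0}
    (h : ∀ g, q' (φ g) = q g) (x : FreeGC R n deg) : aug q' hq' (map φ hφ x) = aug q hq x := by
  refine DFunLike.congr_fun (f := (aug q' hq').comp (map φ hφ)) (algHom_ext fun s => ?_) x
  rw [AlgHom.comp_apply, map_gen, aug_gen, aug_gen, h]

/-- A monomial of positive total degree has a factor of positive degree, and such a factor is mapped
to zero. -/
theorem aug_eq_zero {q : G → B} {hq : ∀ g, deg g ≠ 0 → q g = 0} {m : ℕ} (hm : m ≠ 0)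
    {x : FreeGC R n deg} (hx : x ∈ homog R deg m) : aug q hq x = 0 := by
  induction hx using Submodule.span_induction with
  | zero => simp
  | add x y _ _ hx hy => rw [map_add, hx, hy, add_zero]
  | smul c x _ hx => rw [map_smul, hx, smul_zero]
  | mem x hx =>
    obtain ⟨l, rfl, rfl⟩ := hx
    induction l with
    | nil => simp at hm
    | cons s l ih =>
      simp only [List.map_cons, List.prod_cons, List.sum_cons] at hm ⊢
      rw [map_mul]
      by_cases h : deg s.1 = 0
      · rw [ih (by omega), mul_zero]
      · rw [aug_gen, hq _ h, map_zero, zero_mul]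

variable [Algebra ℝ R] [DRing n R]

theorem map_pd (φ : G → G') (hφ : ∀ g, deg' (φ g) = deg g) (i : Fin n) (x : FreeGC R n deg) :
    map φ hφ (pd i x) = pd i (map φ hφ x) := by
  induction x using induct with
  | h0 r => simp only [pd_algebraMap, AlgHom.commutes]
  | hg s => simp only [pd_gen, map_gen]
  | hm a b ha hb => simp only [pd_mul, map_mul, map_add, ha, hb]
  | ha a b ha hb => simp only [map_add, ha, hb]

/-- Since `φ` preserves degrees, the Leibniz signs on the two sides agree, and the comparison
reduces to the generators. -/
theorem map_diff (φ : G → G') (hφ : ∀ g, deg' (φ g) = deg g) {δ : G → FreeGC R n deg}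
    {hδ : LowersDegree n δ} {δ' : G' → FreeGC R n deg'} {hδ' : LowersDegree n δ'}
    (h : ∀ g, δ' (φ g) = map φ hφ (δ g)) (x : FreeGC R n deg) :
    map φ hφ (diff δ hδ x) = diff δ' hδ' (map φ hφ x) := by
  induction x using induct_cons with
  | h1 => simp [diff_one]
  | hs r x hx => simp only [map_smul, hx]
  | ha x y hx hy => simp only [map_add, hx, hy]
  | hg s x hx =>
    rw [diff_mul _ _ (gen_mem s), map_add, map_smul, map_mul, map_mul, map_mul, hx, map_gen,
      diff_mul _ _ (gen_mem _), diff_gen, diff_gen, hφ, map_iterD _ (map_pd φ hφ), h]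

theorem isDGJetHom_map (φ : G → G') (hφ : ∀ g, deg' (φ g) = deg g) {δ : G → FreeGC R n deg}
    {hδ : LowersDegree n δ} {δ' : G' → FreeGC R n deg'} {hδ' : LowersDegree n δ'}
    (h : ∀ g, δ' (φ g) = map φ hφ (δ g)) :
    IsDGJetHom R n (homog R deg) pd (diff δ hδ) (homog R deg') pd (diff δ' hδ') (map φ hφ) where
  map_mem _ _ ha := map_mem φ hφ ha
  map_d := map_diff φ hφ h
  map_op := map_opAct _ (map_pd φ hφ)

theorem aug_pd (hB : ∀ i j : Fin n, Commute (DRing.pd (R := B) i) (DRing.pd j))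
    (hRB : ∀ (i : Fin n) (r : R), algebraMap R B (DRing.pd i r) = DRing.pd i (algebraMap R B r))
    {q : G → B} {hq : ∀ g, deg g ≠ 0 → q g = 0} (i : Fin n) (x : FreeGC R n deg) :
    aug q hq (pd i x) = DRing.pd i (aug q hq x) := by
  induction x using induct with
  | h0 r =>
    rw [pd_algebraMap, AlgHom.commutes, AlgHom.commutes]
    exact hRB i r
  | hg s =>
    rw [pd_gen, aug_gen, aug_gen]
    exact iterD_add_single_apply hB i s.2 _
  | hm a b ha hb =>
    rw [pd_mul, map_add, map_mul, map_mul, map_mul, ha, hb]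
    refine Eq.trans ?_ ((DRing.der (R := B) i).leibniz _ _).symm
    simp only [smul_eq_mul]
    rw [add_comm, mul_comm (DRing.pd i _)]
    rfl
  | ha a b ha hb => simp only [map_add, ha, hb]

/-- The composite with `d` satisfies a Leibniz rule with values in `B`, and it vanishes on symbols
because the augmentation commutes with `∂^α`. -/
theorem aug_diff (hB : ∀ i j : Fin n, Commute (DRing.pd (R := B) i) (DRing.pd j))
    (hRB : ∀ (i : Fin n) (r : R), algebraMap R B (DRing.pd i r) = DRing.pd i (algebraMap R B r))
    {q : G → B} {hq : ∀ g, deg g ≠ 0 → q g = 0} {δ : G → FreeGC R n deg} {hδ : LowersDegree n δ}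
    (h : ∀ g, aug q hq (δ g) = 0) (x : FreeGC R n deg) : aug q hq (diff δ hδ x) = 0 := by
  induction x using induct_cons with
  | h1 => simp [diff_one]
  | hs r x hx => rw [map_smul, map_smul, hx, smul_zero]
  | ha x y hx hy => rw [map_add, map_add, hx, hy, add_zero]
  | hg s x hx =>
    rw [diff_mul _ _ (gen_mem s), map_add, map_smul, map_mul, map_mul, hx, diff_gen,
      map_iterD _ (aug_pd hB hRB), h, map_zero, zero_mul, mul_zero, smul_zero, add_zero]

end maps

end FreeGC

end KoszulTate

namespace KoszulTate

/-! ### The stages and their colimit. -/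

section Tower

variable {R : Type} [CommRing R] [Algebra ℝ R] {n : ℕ} [DRing n R]
  {B : Type} [CommRing B] [Algebra ℝ B] [Algebra R B] [DRing n B]

/-- Within one stage the new generators are indexed by the cycles they bound. -/
theorem CofGen.J_injective {k m : ℕ} {σ τ : (tower R n B k).Alg}
    {hσ : (tower R n B k).IsObstruction m σ} {hτ : (tower R n B k).IsObstruction m τ}
    (h : CofGen.J k m σ hσ = CofGen.J k m τ hτ) : σ = τ :=
  congrArg (fun z : (tower R n B k).Obstruction => z.1.2) (eq_of_heq (Sigma.mk.inj h).2)

theorem Stage.next_d_gen (S : Stage R n B) (z : S.Obstruction) :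
    S.next.d (FreeGC.gen R S.next.deg (Sum.inr z, 0)) = S.inclNext z.1.2 := by
  rw [Stage.d, FreeGC.diff_gen, iterD_zero]
  rfl

theorem towerGen_level_le (k : ℕ) (g : (tower R n B k).G) : (towerGen R n B k g).1 ≤ k := by
  induction k with
  | zero => exact le_rfl
  | succ k ih =>
    rcases g with g | z
    · exact (ih g).trans (Nat.le_succ k)
    · exact le_rfl

/-- Together with `towerGen_level_le` and `towerGen_injective` this identifies the generators of
stage `k` with those of level at most `k`. -/
theorem exists_towerGen (k : ℕ) (g : CofGen R n B) (hg : g.1 ≤ k) :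
    ∃ g', towerGen R n B k g' = g := by
  induction k with
  | zero =>
    obtain ⟨j, z⟩ := g
    obtain rfl : j = 0 := Nat.le_zero.1 hg
    exact ⟨z, rfl⟩
  | succ k ih =>
    rcases Nat.lt_or_ge k g.1 with h | h
    · obtain ⟨j, z⟩ := g
      obtain rfl : j = k + 1 := le_antisymm hg h
      exact ⟨Sum.inr z, rfl⟩
    · obtain ⟨g', h'⟩ := ih h
      exact ⟨Sum.inl g', h'⟩

/-- The level separates the old generators from the new ones of level `k + 1`; each of the two kinds
is embedded. -/
theorem towerGen_injective (k : ℕ) : Function.Injective (towerGen R n B k) := by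
  induction k with
  | zero => exact fun a b h => eq_of_heq (Sigma.mk.inj h).2
  | succ k ih =>
    have hne (g : (tower R n B k).G) (z : NewGen R n B (k + 1)) :
        towerGen R n B k g ≠ ⟨k + 1, z⟩ := fun h => by
      have := towerGen_level_le k g
      rw [h] at this
      exact absurd this (Nat.not_succ_le_self k)
    rintro (a | a) (b | b) h
    · exact congrArg Sum.inl (ih h)
    · exact absurd h (hne a b)
    · exact absurd h.symm (hne b a)
    · exact congrArg Sum.inr (eq_of_heq (Sigma.mk.inj h).2)

theorem towerIncl_injective (k : ℕ) : Function.Injective (towerIncl R n B k) :=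
  FreeGC.map_injective _ _ (towerGen_injective k)

theorem towerIncl_inclNext (k : ℕ) (x : (tower R n B k).Alg) :
    towerIncl R n B (k + 1) ((tower R n B k).inclNext x) = towerIncl R n B k x :=
  FreeGC.map_map _ _ _ _ _ _ (fun _ => rfl) x

theorem cofBdry_towerGen (k : ℕ) (g : (tower R n B k).G) :
    cofBdry R n B (towerGen R n B k g) = towerIncl R n B k ((tower R n B k).δ g) := by
  induction k with
  | zero => exact (map_zero _).symm
  | succ k ih =>
    rcases g with g | z
    · exact (ih g).trans (towerIncl_inclNext k _).symm
    · exact (towerIncl_inclNext k _).symm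

theorem towerIncl_d (k : ℕ) (x : (tower R n B k).Alg) :
    towerIncl R n B k ((tower R n B k).d x) = cofDiff R n B (towerIncl R n B k x) :=
  FreeGC.map_diff _ _ (cofBdry_towerGen k) x

theorem cofAugGen_towerGen (k : ℕ) (g : (tower R n B k).G) :
    cofAugGen R n B (towerGen R n B k g) = (tower R n B k).q g := by
  induction k with
  | zero => rfl
  | succ k ih =>
    rcases g with g | z
    · exact ih g
    · rfl

theorem cofAug_towerIncl (k : ℕ) (x : (tower R n B k).Alg) :
    cofAug R n B (towerIncl R n B k x) = (tower R n B k).aug x :=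
  FreeGC.aug_map _ _ (cofAugGen_towerGen k) x

/-- Each homogeneous element comes from all sufficiently late stages. -/
theorem exists_towerIncl {m : ℕ} {x : Cof R n B} (hx : x ∈ FreeGC.homog R (cofDeg R n B) m) :
    ∃ k, ∀ k' ≥ k, ∃ y ∈ FreeGC.homog R (tower R n B k').deg m, towerIncl R n B k' y = x := by
  induction hx using Submodule.span_induction with
  | zero => exact ⟨0, fun k' _ => ⟨0, zero_mem _, map_zero _⟩⟩
  | add x y _ _ hx hy =>
    obtain ⟨k, hk⟩ := hx
    obtain ⟨l, hl⟩ := hy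
    refine ⟨max k l, fun k' h => ?_⟩
    obtain ⟨a, ha, rfl⟩ := hk k' (le_trans (le_max_left _ _) h)
    obtain ⟨b, hb, rfl⟩ := hl k' (le_trans (le_max_right _ _) h)
    exact ⟨a + b, add_mem ha hb, map_add _ _ _⟩
  | smul c x _ hx =>
    obtain ⟨k, hk⟩ := hx
    refine ⟨k, fun k' h => ?_⟩
    obtain ⟨a, ha, rfl⟩ := hk k' h
    exact ⟨c • a, Submodule.smul_mem _ _ ha, map_smul _ _ _⟩
  | mem x hx =>
    obtain ⟨l, rfl, rfl⟩ := hx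
    induction l with
    | nil => exact ⟨0, fun k' _ => ⟨1, SetLike.GradedOne.one_mem, map_one _⟩⟩
    | cons s l ih =>
      obtain ⟨k, hk⟩ := ih
      -- A monomial is available as soon as the stage has passed the level of its first generator
      -- and the bound for the remaining factor.
      refine ⟨max s.1.1 k, fun k' h => ?_⟩
      obtain ⟨g, hg⟩ := exists_towerGen k' s.1 (le_trans (le_max_left _ _) h)
      obtain ⟨b, hb, hb'⟩ := hk k' (le_trans (le_max_right _ _) h)
      refine ⟨FreeGC.gen R (tower R n B k').deg (g, s.2) * b, ?_, ?_⟩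
      · simp only [List.map_cons, List.sum_cons]
        rw [← hg, cofDeg_towerGen]
        exact FreeGC.mul_mem (FreeGC.gen_mem (g, s.2)) hb
      · simp only [List.map_cons, List.prod_cons]
        rw [map_mul, hb', towerIncl, FreeGC.map_gen, hg]

/-- A cycle that is zero in `B` is the boundary of a new generator of each sufficiently late
stage. -/
theorem exists_cofBdry_eq {m : ℕ} {σ : Cof R n B} (hσ : σ ∈ FreeGC.homog R (cofDeg R n B) m)
    (hd : cofDiff R n B σ = 0) (hq : cofAug R n B σ = 0) :
    ∃ k, ∀ k' ≥ k, ∃ g : CofGen R n B, g.1 = k' + 1 ∧ cofDeg R n B g = m + 1 ∧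
      cofBdry R n B g = σ := by
  obtain ⟨k, hk⟩ := exists_towerIncl hσ
  refine ⟨k, fun k' h => ?_⟩
  obtain ⟨y, hy, rfl⟩ := hk k' h
  -- The preimage `y` is a cycle of its stage because the stage embeds in the colimit; its value in
  -- `B` is that of its image.
  refine ⟨CofGen.J k' m y ⟨hy, towerIncl_injective k' ?_, ?_⟩, rfl, rfl, rfl⟩
  · rw [towerIncl_d, hd, map_zero]
  · rw [← cofAug_towerIncl, hq]

/-- Finitely many cycles are boundaries of distinct generators of arbitrarily late stages. -/
theorem exists_injective_cofBdry_eq {m N : ℕ} (M : ℕ) (σ : Fin N → Cof R n B)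
    (hσ : ∀ j, σ j ∈ FreeGC.homog R (cofDeg R n B) m)
    (hd : ∀ j, cofDiff R n B (σ j) = 0) (hq : ∀ j, cofAug R n B (σ j) = 0) :
    ∃ g : Fin N → CofGen R n B, Function.Injective g ∧ (∀ j, M < (g j).1) ∧
      ∀ j, cofDeg R n B (g j) = m + 1 ∧ cofBdry R n B (g j) = σ j := by
  choose k hk using fun j => exists_cofBdry_eq (hσ j) (hd j) (hq j)
  -- The stage used for `j` is shifted by `j`, so that different indices give generators of
  -- different levels even where the cycles coincide. The supremum clears all the bounds `k j`, and
  -- the summand `M` pushes all levels above `M`.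
  have hle (j : Fin N) : k j ≤ M + Finset.univ.sup k + j :=
    (Finset.le_sup (Finset.mem_univ j)).trans (by omega)
  choose g h1 h2 using fun j => hk j _ (hle j)
  refine ⟨g, fun a b h => Fin.ext ?_, fun j => ?_, h2⟩
  · have := (h1 a).symm.trans ((congrArg Sigma.fst h).trans (h1 b))
    omega
  · have := h1 j
    omega

/-! ### The colimit is a resolution. -/

section resolution

/-- A generator of positive level was added on account of a cycle, and the inclusion of its stage
commutes with the differentials. -/
theorem cofDiff_cofBdry (g : CofGen R n B) : cofDiff R n B (cofBdry R n B g) = 0 := by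
  obtain ⟨_ | k, z⟩ := g
  · exact map_zero _
  · refine (towerIncl_d k z.1.2).symm.trans ?_
    rw [z.2.2.1, map_zero]

theorem cofAug_cofBdry (g : CofGen R n B) : cofAug R n B (cofBdry R n B g) = 0 := by
  obtain ⟨_ | k, z⟩ := g
  · exact map_zero _
  · exact (cofAug_towerIncl k z.1.2).trans z.2.2.2

theorem isDGJetAlgebra_cof
    (hR : ∀ i j : Fin n, Commute (DRing.pd (R := R) i) (DRing.pd j)) :
    IsDGJetAlgebra R n (FreeGC.homog R (cofDeg R n B)) FreeGC.pd (cofDiff R n B) :=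
  FreeGC.isDGJetAlgebra hR cofDiff_cofBdry

theorem cofAug_gen_I (b : B) :
    cofAug R n B (FreeGC.gen R (cofDeg R n B) (CofGen.I R n b, 0)) = b := by
  rw [cofAug, FreeGC.aug_gen, iterD_zero]
  rfl

theorem cofDiff_gen (g : CofGen R n B) :
    cofDiff R n B (FreeGC.gen R (cofDeg R n B) (g, 0)) = cofBdry R n B g := by
  rw [cofDiff, FreeGC.diff_gen, iterD_zero]
  rfl

theorem isResolution_cof
    (hB : ∀ i j : Fin n, Commute (DRing.pd (R := B) i) (DRing.pd j))
    (hRB : ∀ (i : Fin n) (r : R), algebraMap R B (DRing.pd i r) = DRing.pd i (algebraMap R B r)) :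
    IsResolution R n (FreeGC.homog R (cofDeg R n B)) FreeGC.pd (cofDiff R n B) (cofAug R n B) where
  map_op P a := map_opAct (cofAug R n B) (FreeGC.aug_pd hB hRB) P a
  map_pos m hm a ha := FreeGC.aug_eq_zero (hq := cofAugGen_pos R n B) hm ha
  map_d a := FreeGC.aug_diff (hq := cofAugGen_pos R n B) (hδ := cofBdry_lowers R n B) hB hRB
    cofAug_cofBdry a
  surjective b := ⟨FreeGC.gen R (cofDeg R n B) (CofGen.I R n b, 0),
    FreeGC.gen_mem (CofGen.I R n b, 0), cofAug_gen_I b⟩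
  exact m a ha hd hq := by
    -- The cycle is killed by a generator itself, not merely by a combination of generators.
    obtain ⟨k, hk⟩ := exists_cofBdry_eq ha hd hq
    obtain ⟨g, -, hg, rfl⟩ := hk k le_rfl
    exact ⟨FreeGC.gen R (cofDeg R n B) (g, 0), hg ▸ FreeGC.gen_mem (g, 0), cofDiff_gen g⟩

end resolution

end Tower

end KoszulTate

/-! ### Euler-Lagrange functions and Noether operators of the gauge theory. -/

namespace KoszulTate
namespace RegularGaugeTheory

variable {n r : ℕ} (T : RegularGaugeTheory n r)

theorem jetFun_pd_commute (i j : Fin n) : Commute (DRing.pd (R := JetFun n r) i) (DRing.pd j) :=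
  AddMonoidHom.ext (pd_comm i j)

theorem algebraMap_pd (i : Fin n) (f : JetFun n r) :
    algebraMap (JetFun n r) T.ShellFun (DRing.pd i f) = DRing.pd i (algebraMap _ T.ShellFun f) :=
  rfl

theorem shellFun_pd_commute (i j : Fin n) :
    Commute (DRing.pd (R := T.ShellFun) i) (DRing.pd j) := by
  refine AddMonoidHom.ext fun x => ?_
  obtain ⟨f, rfl⟩ := Ideal.Quotient.mk_surjective x
  exact congrArg (Ideal.Quotient.mk T.shellIdeal) (pd_comm i j f)

theorem EL_mem_shellIdeal (a : Fin r) : T.EL a ∈ T.shellIdeal := fun p hp => by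
  have := hp a 0
  rwa [iterD_zero] at this

theorem eval_R (δ : Fin T.K) : TDO.eval T.EL (T.R δ) = 0 := by
  rw [R, map_sub, sub_eq_zero]
  refine (T.dependent (δ, 0)).trans ?_
  rw [map_finsuppSum]
  exact Finsupp.sum_congr fun b _ => (map_smul (TDO.eval T.EL) _ _).symm

/-- The reducibility matrix sends the basis vector of index `(δ, 0)` to the dependent-package part
of `R_δ`. If two Noether operators agreed, two basis vectors would have the same image. -/
theorem R_injective : Function.Injective T.R := by
  intro δ δ' h
  have hi := T.reducibility.injective
  have := @hi (Finsupp.single (δ, 0) 1) (Finsupp.single (δ', 0) 1) (by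
    rw [Finsupp.linearCombination_single, Finsupp.linearCombination_single, iterD_zero]
    exact congrArg (fun N => (1 : JetFun n r) • (Finsupp.sumFinsuppEquivProdFinsupp
      (T.M.repr N)).2) h)
  exact congrArg Prod.fst (Finsupp.single_left_injective one_ne_zero this)

/-! ### The chains `∑ R^a_(δα) (∂^α · φ_a)`. -/

section chain

variable {G : Type} {deg : G → ℕ}

theorem noetherChain_mem {φ : Fin r → FreeGC (JetFun n r) n deg} {m : ℕ}
    (hφ : ∀ a, φ a ∈ FreeGC.homog (JetFun n r) deg m) (δ : Fin T.K) :
    T.noetherChain φ δ ∈ FreeGC.homog (JetFun n r) deg m :=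
  Submodule.sum_mem _ fun c _ => Submodule.smul_mem _ _ (FreeGC.iterD_mem _ (hφ c.1))

theorem map_noetherChain {G' : Type} {deg' : G' → ℕ} {F : Type}
    [FunLike F (FreeGC (JetFun n r) n deg) (FreeGC (JetFun n r) n deg')]
    [LinearMapClass F (JetFun n r) (FreeGC (JetFun n r) n deg) (FreeGC (JetFun n r) n deg')]
    (f : F) (hf : ∀ i x, f (FreeGC.pd i x) = FreeGC.pd i (f x))
    (φ : Fin r → FreeGC (JetFun n r) n deg) (δ : Fin T.K) :
    f (T.noetherChain φ δ) = T.noetherChain (fun a => f (φ a)) δ := by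
  simp only [noetherChain, Finsupp.sum, map_sum, map_smul, map_iterD f hf]

/-- This is the Noether identity `eval_R`, carried into the algebra by the structure map. -/
theorem noetherChain_EL (δ : Fin T.K) :
    T.noetherChain (fun a => algebraMap (JetFun n r) (FreeGC (JetFun n r) n deg) (T.EL a)) δ =
      0 := by
  have h := congrArg (algebraMap (JetFun n r) (FreeGC (JetFun n r) n deg)) (T.eval_R δ)
  rw [map_zero, TDO.eval, Finsupp.linearCombination_apply, map_finsuppSum] at h
  rw [← h]
  refine Finsupp.sum_congr fun c _ => ?_
  rw [FreeGC.iterD_algebraMap, smul_eq_mul, map_mul, ← Algebra.smul_def]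

/-- `∑ R^a_(δα) (∂^α · φ_a)` is a cycle if `φ_a` has boundary `δ_{u^a} L`. -/
theorem diff_noetherChain {δ : G → FreeGC (JetFun n r) n deg} {hδ : FreeGC.LowersDegree n δ}
    {φ : Fin r → FreeGC (JetFun n r) n deg}
    (hφ : ∀ a, FreeGC.diff δ hδ (φ a) = algebraMap _ _ (T.EL a)) (e : Fin T.K) :
    FreeGC.diff δ hδ (T.noetherChain φ e) = 0 := by
  rw [T.map_noetherChain _ (FreeGC.diff_pd jetFun_pd_commute)]
  simp only [hφ, T.noetherChain_EL]

theorem noetherChain_gen (s : Fin r → G) (δ : Fin T.K) :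
    T.noetherChain (fun a => FreeGC.gen (JetFun n r) deg (s a, 0)) δ =
      (T.R δ).sum fun c f => f • FreeGC.gen (JetFun n r) deg (s c.1, c.2) := by
  simp only [noetherChain, FreeGC.iterD_gen jetFun_pd_commute]

/-- The chain is linear in the generators, so its coefficients give back `R_δ`, provided that
distinct `a` have distinct generators; `R_injective` then separates the indices `δ`. -/
theorem noetherChain_gen_injective {s : Fin r → G} (hs : Function.Injective s) :
    Function.Injective (T.noetherChain fun a => FreeGC.gen (JetFun n r) deg (s a, 0)) := by
  have key (δ : Fin T.K) (a : Fin r) (α : MultiIndex n) : FreeGC.coeff (s a, α)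
      (T.noetherChain (fun a => FreeGC.gen (JetFun n r) deg (s a, 0)) δ) = T.R δ (a, α) := by
    classical
    rw [noetherChain_gen, Finsupp.sum, map_sum]
    have e (c : Fin r × MultiIndex n) : FreeGC.coeff (s a, α)
        (T.R δ c • FreeGC.gen (JetFun n r) deg (s c.1, c.2)) =
          if c = (a, α) then T.R δ c else 0 := by
      -- Injectivity of `s` enters here: otherwise coefficients for several `a` would be added up.
      have : (s c.1, c.2) = (s a, α) ↔ c = (a, α) := by
        rw [Prod.ext_iff, Prod.ext_iff]
        exact and_congr_left fun _ => hs.eq_iff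
      rw [map_smul, FreeGC.coeff_gen, smul_eq_mul]
      simp only [this, mul_ite, mul_one, mul_zero]
    simp only [e, Finset.sum_ite_eq', Finsupp.mem_support_iff]
    split_ifs with h
    · rfl
    · exact (not_not.1 h).symm
  intro δ δ' h
  refine T.R_injective (Finsupp.ext fun c => ?_)
  rw [← key δ c.1 c.2, h, key]

end chain

theorem ktDiff_ktBdry (g : Fin r ⊕ Fin T.K) : T.ktDiff (T.ktBdry g) = 0 := by
  rcases g with a | δ
  · exact FreeGC.diff_algebraMap _
  · refine T.diff_noetherChain (fun a => ?_) δ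
    rw [antifield, FreeGC.diff_gen, iterD_zero]
    rfl

theorem isDGJetAlgebra_kt : IsDGJetAlgebra (JetFun n r) n T.ktGrading FreeGC.pd T.ktDiff :=
  FreeGC.isDGJetAlgebra jetFun_pd_commute T.ktDiff_ktBdry

/-! ### Morphisms from `KT` to `𝒦𝒯` given by generators. -/

section hom

theorem cofDeg_elim {ga : Fin r → CofGen (JetFun n r) n T.ShellFun}
    {gC : Fin T.K → CofGen (JetFun n r) n T.ShellFun}
    (ha : ∀ a, cofDeg (JetFun n r) n T.ShellFun (ga a) = 1)
    (hC : ∀ δ, cofDeg (JetFun n r) n T.ShellFun (gC δ) = 2) (g : Fin r ⊕ Fin T.K) :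
    cofDeg (JetFun n r) n T.ShellFun (Sum.elim ga gC g) = T.antifieldDeg g := by
  rcases g with a | δ
  · exact ha a
  · exact hC δ

variable {ga : Fin r → CofGen (JetFun n r) n T.ShellFun}
  {gC : Fin T.K → CofGen (JetFun n r) n T.ShellFun}

/-- The algebra map `KT → 𝒦𝒯` given by a map of the generators. -/
noncomputable def homOfGens (ha : ∀ a, cofDeg (JetFun n r) n T.ShellFun (ga a) = 1)
    (hC : ∀ δ, cofDeg (JetFun n r) n T.ShellFun (gC δ) = 2) : T.KT →ₐ[JetFun n r] T.CofKT :=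
  FreeGC.map (Sum.elim ga gC) (T.cofDeg_elim ha hC)

theorem homOfGens_antifield (ha : ∀ a, cofDeg (JetFun n r) n T.ShellFun (ga a) = 1)
    (hC : ∀ δ, cofDeg (JetFun n r) n T.ShellFun (gC δ) = 2) (a : Fin r) :
    T.homOfGens ha hC (T.antifield a) = T.cofGen (ga a) :=
  FreeGC.map_gen _ _ _

theorem homOfGens_antifieldC (ha : ∀ a, cofDeg (JetFun n r) n T.ShellFun (ga a) = 1)
    (hC : ∀ δ, cofDeg (JetFun n r) n T.ShellFun (gC δ) = 2) (δ : Fin T.K) :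
    T.homOfGens ha hC (T.antifieldC δ) = T.cofGen (gC δ) :=
  FreeGC.map_gen _ _ _

/-- Compatibility with the differentials is needed only for the antifields. For `C*_δ` the required
boundary is the Noether chain of the images of the `φ*_a`, because the induced map is `ℱ[𝒟]`-linear.
-/
theorem isHomKT_homOfGens (ha : ∀ a, cofDeg (JetFun n r) n T.ShellFun (ga a) = 1)
    (hC : ∀ δ, cofDeg (JetFun n r) n T.ShellFun (gC δ) = 2)
    (hda : ∀ a, cofBdry (JetFun n r) n T.ShellFun (ga a) = algebraMap _ _ (T.EL a))
    (hdC : ∀ δ, cofBdry (JetFun n r) n T.ShellFun (gC δ) =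
      T.noetherChain (fun a => T.cofGen (ga a)) δ) : T.IsHomKT (T.homOfGens ha hC) := by
  refine FreeGC.isDGJetHom_map _ (T.cofDeg_elim ha hC) fun g => ?_
  rcases g with a | δ
  · exact (hda a).trans (AlgHom.commutes _ _).symm
  · refine (hdC δ).trans ?_
    refine Eq.trans ?_ (T.map_noetherChain _ (FreeGC.map_pd _ (T.cofDeg_elim ha hC)) _ δ).symm
    exact congrArg (fun φ => T.noetherChain φ δ)
      (funext fun a => (T.homOfGens_antifield ha hC a).symm)

theorem homOfGens_injective_iff (ha : ∀ a, cofDeg (JetFun n r) n T.ShellFun (ga a) = 1)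
    (hC : ∀ δ, cofDeg (JetFun n r) n T.ShellFun (gC δ) = 2) :
    Function.Injective (T.homOfGens ha hC) ↔ Function.Injective (Sum.elim ga gC) := by
  refine ⟨fun h s t hst => ?_, FreeGC.map_injective _ _⟩
  have := @h (FreeGC.gen (JetFun n r) T.antifieldDeg (s, 0))
    (FreeGC.gen (JetFun n r) T.antifieldDeg (t, 0)) (by
      rw [homOfGens, FreeGC.map_gen, FreeGC.map_gen, hst])
  exact congrArg Prod.fst (FreeGC.gen_injective this)

theorem IsHomKT.ext {i j : T.KT →ₐ[JetFun n r] T.CofKT} (hi : T.IsHomKT i) (hj : T.IsHomKT j)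
    (ha : ∀ a, i (T.antifield a) = j (T.antifield a))
    (hC : ∀ δ, i (T.antifieldC δ) = j (T.antifieldC δ)) : i = j := by
  refine FreeGC.algHom_ext fun s => ?_
  have h0 : i (FreeGC.gen _ _ (s.1, 0)) = j (FreeGC.gen _ _ (s.1, 0)) := by
    rcases s.1 with a | δ
    · exact ha a
    · exact hC δ
  -- The operator `∂^α` alone produces the symbol `∂^α g` from `g`.
  have h1 := hi.map_op (Finsupp.single s.2 1) (FreeGC.gen _ _ (s.1, 0))
  rw [h0, ← hj.map_op, opAct_single_one, FreeGC.iterD_gen jetFun_pd_commute] at h1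
  exact h1

end hom

theorem cofAug_EL (a : Fin r) : T.cofAug (algebraMap _ _ (T.EL a)) = 0 :=
  (AlgHom.commutes _ _).trans (Ideal.Quotient.eq_zero_iff_mem.2 (T.EL_mem_shellIdeal a))

theorem cofGen_mem {g : CofGen (JetFun n r) n T.ShellFun} {m : ℕ}
    (hg : cofDeg (JetFun n r) n T.ShellFun g = m) :
    T.cofGen g ∈ FreeGC.homog (JetFun n r) (cofDeg (JetFun n r) n T.ShellFun) m :=
  hg ▸ FreeGC.gen_mem (g, 0)

/-- The images of the `φ*_a` are chosen before those of the `C*_δ`, since the cycles to be bounded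
by the latter are formed from the former. Coinciding Euler-Lagrange functions do no harm, as their
generators are taken from different stages. -/
theorem exists_injective_hom : ∃ i : T.KT →ₐ[JetFun n r] T.CofKT, T.IsHomKT i ∧
    Function.Injective i ∧ (∀ a, ∃ g, i (T.antifield a) = T.cofGen g) ∧
      (∀ δ, ∃ g, i (T.antifieldC δ) = T.cofGen g) := by
  obtain ⟨ga, hga, -, ha⟩ := exists_injective_cofBdry_eq (R := JetFun n r) (n := n)
    (B := T.ShellFun) (m := 0) 0 (fun a : Fin r => algebraMap _ _ (T.EL a))
    (fun a => FreeGC.algebraMap_mem _) (fun a => FreeGC.diff_algebraMap _) T.cofAug_EL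
  have hmem (δ : Fin T.K) := T.noetherChain_mem (φ := fun a => T.cofGen (ga a)) (m := 1)
    (fun a => T.cofGen_mem (ha a).1) δ
  -- Levels above those of all `ga a` keep the two families of generators disjoint.
  obtain ⟨gC, hgC, hM, hC⟩ := exists_injective_cofBdry_eq (Finset.univ.sup fun a => (ga a).1)
    (T.noetherChain fun a => T.cofGen (ga a)) hmem
    (T.diff_noetherChain fun a => (cofDiff_gen (ga a)).trans (ha a).2)
    (fun δ => FreeGC.aug_eq_zero one_ne_zero (hmem δ))
  refine ⟨T.homOfGens (fun a => (ha a).1) (fun δ => (hC δ).1),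
    T.isHomKT_homOfGens _ _ (fun a => (ha a).2) (fun δ => (hC δ).2),
    (T.homOfGens_injective_iff _ _).2 (hga.sumElim hgC fun a δ h => ?_),
    fun a => ⟨_, T.homOfGens_antifield _ _ a⟩, fun δ => ⟨_, T.homOfGens_antifieldC _ _ δ⟩⟩
  have := (Finset.le_sup (f := fun a => (ga a).1) (Finset.mem_univ a)).trans_lt (hM δ)
  exact this.ne (congrArg Sigma.fst h)

/-! ### The morphism into the first two stages. -/

section canonical

theorem isObstruction_stageEL (a : Fin r) : (T.stage 0).IsObstruction 0 (T.stageEL a) :=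
  ⟨FreeGC.algebraMap_mem _, FreeGC.diff_algebraMap _, (AlgHom.commutes _ _).trans
    (Ideal.Quotient.eq_zero_iff_mem.2 (T.EL_mem_shellIdeal a))⟩

variable (h₁ : ∀ a, (T.stage 0).IsObstruction 0 (T.stageEL a))

theorem stageAntifield_mem (a : Fin r) :
    T.stageAntifield h₁ a ∈ FreeGC.homog (JetFun n r) (T.stage 1).deg 1 :=
  FreeGC.gen_mem (deg := (T.stage 1).deg) (Sum.inr ⟨(0, T.stageEL a), h₁ a⟩, 0)

theorem d_stageAntifield (a : Fin r) :
    FreeGC.diff (T.stage 1).δ (T.stage 1).lowers (T.stageAntifield h₁ a) =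
      algebraMap (JetFun n r) (FreeGC (JetFun n r) n (T.stage 1).deg) (T.EL a) := by
  exact ((T.stage 0).next_d_gen ⟨(0, T.stageEL a), h₁ a⟩).trans
    (AlgHom.commutes (T.stage 0).inclNext (T.EL a))

theorem isObstruction_stageNoether (δ : Fin T.K) :
    (T.stage 1).IsObstruction 1 (T.stageNoether h₁ δ) := by
  have hm : T.stageNoether h₁ δ ∈ FreeGC.homog (JetFun n r) (T.stage 1).deg 1 :=
    T.noetherChain_mem (T.stageAntifield_mem h₁) δ
  exact ⟨hm, T.diff_noetherChain (T.d_stageAntifield h₁) δ,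
    FreeGC.aug_eq_zero (hq := (T.stage 1).q_pos) one_ne_zero hm⟩

/-- The cycle formed in stage `1` has to be compared with the boundary required in the colimit. -/
theorem towerIncl_stageNoether (δ : Fin T.K) :
    towerIncl (JetFun n r) n T.ShellFun 1 (T.stageNoether h₁ δ) =
      T.noetherChain (fun a => T.cofGen (CofGen.J 0 0 (T.stageEL a) (h₁ a))) δ := by
  rw [stageNoether, towerIncl, T.map_noetherChain _ (FreeGC.map_pd _ _)]
  exact congrArg (fun φ => T.noetherChain φ δ) (funext fun a => FreeGC.map_gen _ _ _)

variable (h₂ : ∀ δ, (T.stage 1).IsObstruction 1 (T.stageNoether h₁ δ))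

theorem cofDeg_J_stageEL (a : Fin r) :
    cofDeg (JetFun n r) n T.ShellFun (CofGen.J 0 0 (T.stageEL a) (h₁ a)) = 1 :=
  rfl

theorem cofDeg_J_stageNoether (δ : Fin T.K) :
    cofDeg (JetFun n r) n T.ShellFun (CofGen.J 1 1 (T.stageNoether h₁ δ) (h₂ δ)) = 2 :=
  rfl

/-- The map `KT → 𝒦𝒯` that sends each antifield to the generator bounding the cycle `δ_{u^a} L`
or `∑ R^a_(δα) (∂^α · I^1)`. -/
noncomputable def canonicalHom : T.KT →ₐ[JetFun n r] T.CofKT :=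
  T.homOfGens (T.cofDeg_J_stageEL h₁) (T.cofDeg_J_stageNoether h₁ h₂)

theorem canonicalHom_antifield (a : Fin r) : T.canonicalHom h₁ h₂ (T.antifield a) =
    T.cofGen (CofGen.J 0 0 (T.stageEL a) (h₁ a)) :=
  T.homOfGens_antifield _ _ a

theorem canonicalHom_antifieldC (δ : Fin T.K) : T.canonicalHom h₁ h₂ (T.antifieldC δ) =
    T.cofGen (CofGen.J 1 1 (T.stageNoether h₁ δ) (h₂ δ)) :=
  T.homOfGens_antifieldC _ _ δ

theorem isHomKT_canonicalHom : T.IsHomKT (T.canonicalHom h₁ h₂) :=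
  T.isHomKT_homOfGens _ _ (fun _ => AlgHom.commutes _ _) (T.towerIncl_stageNoether h₁)

/-- Injectivity is a question about generators. Those for the `φ*_a` coincide exactly when the
functions do. Those for the `C*_δ` are separated by their Noether chains once the former are
distinct. -/
theorem canonicalHom_injective_iff :
    Function.Injective (T.canonicalHom h₁ h₂) ↔ Function.Injective T.EL := by
  rw [canonicalHom, homOfGens_injective_iff]
  have hJ (a b : Fin r) : CofGen.J 0 0 (T.stageEL a) (h₁ a) = CofGen.J 0 0 (T.stageEL b) (h₁ b) ↔
      T.EL a = T.EL b := by
    refine ⟨fun h => FreeGC.algebraMap_injective (CofGen.J_injective h), fun h => ?_⟩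
    have : T.stageEL a = T.stageEL b := congrArg (algebraMap (JetFun n r) (T.stage 0).Alg) h
    simp only [this]
  constructor
  · intro h a b hab
    exact Sum.inl_injective (@h (Sum.inl a) (Sum.inl b) ((hJ a b).2 hab))
  · intro h
    refine Function.Injective.sumElim (fun a b hab => h ((hJ a b).1 hab)) (fun δ δ' hδ => ?_)
      -- The two kinds of generators have levels `1` and `2`.
      fun a δ haδ => absurd (congrArg Sigma.fst haδ) (by simp [CofGen.J])
    refine T.noetherChain_gen_injective (deg := (T.stage 1).deg)
      (s := fun a => Sum.inr ⟨(0, T.stageEL a), h₁ a⟩) (fun a b hab => h ?_)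
      (CofGen.J_injective hδ)
    exact FreeGC.algebraMap_injective (congrArg (fun z : (T.stage 0).Obstruction => z.1.2)
      (Sum.inr_injective hab))

end canonical

end RegularGaugeTheory
end KoszulTate

/-! ### Assembly of the proposition. -/

theorem mainTheorem4 {n r : ℕ} (T : KoszulTate.RegularGaugeTheory n r) :
    KoszulTate.IsDGJetAlgebra (KoszulTate.JetFun n r) n
      T.ktGrading KoszulTate.FreeGC.pd T.ktDiff ∧
    KoszulTate.IsDGJetAlgebra (KoszulTate.JetFun n r) n
      T.cofGrading KoszulTate.FreeGC.pd T.cofDiff ∧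
    KoszulTate.IsResolution (KoszulTate.JetFun n r) n (B := T.ShellFun)
      T.cofGrading KoszulTate.FreeGC.pd T.cofDiff T.cofAug ∧
    (∃ i : T.KT →ₐ[KoszulTate.JetFun n r] T.CofKT, T.IsHomKT i ∧ Function.Injective i ∧
      (∀ a, ∃ g, i (T.antifield a) = T.cofGen g) ∧
      (∀ δ, ∃ g, i (T.antifieldC δ) = T.cofGen g)) ∧
    (∃ (h₁ : ∀ a, (T.stage 0).IsObstruction 0 (T.stageEL a))
      (h₂ : ∀ δ, (T.stage 1).IsObstruction 1 (T.stageNoether h₁ δ))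
      (i : T.KT →ₐ[KoszulTate.JetFun n r] T.CofKT),
      (T.IsHomKT i ∧
        (∀ a, i (T.antifield a) = T.cofGen (KoszulTate.CofGen.J 0 0 (T.stageEL a) (h₁ a))) ∧
        (∀ δ, i (T.antifieldC δ) =
          T.cofGen (KoszulTate.CofGen.J 1 1 (T.stageNoether h₁ δ) (h₂ δ)))) ∧
      (∀ i' : T.KT →ₐ[KoszulTate.JetFun n r] T.CofKT, T.IsHomKT i' →
        (∀ a, i' (T.antifield a) = T.cofGen (KoszulTate.CofGen.J 0 0 (T.stageEL a) (h₁ a))) →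
        (∀ δ, i' (T.antifieldC δ) =
          T.cofGen (KoszulTate.CofGen.J 1 1 (T.stageNoether h₁ δ) (h₂ δ))) → i' = i) ∧
      (Function.Injective i ↔ Function.Injective T.EL)) := by
  refine ⟨T.isDGJetAlgebra_kt,
    KoszulTate.isDGJetAlgebra_cof KoszulTate.RegularGaugeTheory.jetFun_pd_commute,
    KoszulTate.isResolution_cof T.shellFun_pd_commute T.algebraMap_pd,
    T.exists_injective_hom, T.isObstruction_stageEL, T.isObstruction_stageNoether _,
    T.canonicalHom _ _,
    ⟨T.isHomKT_canonicalHom _ _, T.canonicalHom_antifield _ _, T.canonicalHom_antifieldC _ _⟩,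
    fun i' hi ha hC => ?_, T.canonicalHom_injective_iff _ _⟩
  exact KoszulTate.RegularGaugeTheory.IsHomKT.ext T hi (T.isHomKT_canonicalHom _ _)
    (fun a => (ha a).trans (T.canonicalHom_antifield _ _ a).symm)
    fun δ => (hC δ).trans (T.canonicalHom_antifieldC _ _ δ).symm
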